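/- **Setting.** Let $n\ge 1$, $T\ge 2$, let $P=(p_{ij})\in[0,1]^{n\times n}$ be symmetric and $\alpha\in(0,1)$. A sequence $A^{(1)},\dots,A^{(T)}$ of random symmetric $\{0,1\}$-valued $n\times n$ matrices follows the lazy inhomogeneous Erdős–Rényi process with mean adjacency matrix $P$ and laziness $\alpha$ if the entries $A^{(1)}_{ij}$, $1\le i\le j\le n$, are independent with $A^{(1)}_{ij}\sim\mathrm{Bernoulli}(p_{ij})$ and, for each $t\in\{2,\dots,T\}$, given $A^{(1)},\dots,A^{(t-1)}$, the entries $A^{(t)}_{ij}$, $1\le i\le j\le n$, are conditionally independent, each being equal to $A^{(t-1)}_{ij}$ with probability $\alpha$ and drawn afresh from $\mathrm{Bernoulli}(p_{ij})$ with probability $1-\alpha$. Put $A=\sum_{t=1}^T A^{(t)}$, $\bar A=\mathbb E A$, let $D$ be the diagonal matrix of the aggregated degrees $d_i=\sum_{t=1}^T\sum_{j=1}^n A^{(t)}_{ij}$, $\bar D=\mathbb E D$, and $$\mathcal L=I_n-D^{-1/2}AD^{-1/2},\qquad \bar{\mathcal L}=I_n-\bar D^{-1/2}\bar A\bar D^{-1/2},$$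 where $0^{-1/2}:=0$ on the diagonal. Let $d_{\max}=\max_i\sum_j p_{ij}$, $d_{\min}=\min_i\sum_j p_{ij}$, and let $\|\cdot\|$ be the operator norm of matrices with respect to the Euclidean norm. **Theorem.** There is a function $C_2:(0,1)\to(0,\infty)$, and for every $c>0$ there are a constant $C=C(c)>0$ and a function $C_1(\cdot,c):(0,1)\to(0,\infty)$, such that for all $n\ge1$, $T\ge2$, $P$ and $\alpha$ as above and every sequence $(A^{(t)})_{t\le T}$ following the lazy inhomogeneous Erdős–Rényi process with parameters $P$ and $\alpha$: (A) If $T d_{\max}>C(\log n)^3$, then for every $\delta\in(n^{-c},1/2)$, $$\mathbb P\Big(\|A-\bar A\|\le C_1(\alpha,c)\sqrt{T d_{\max}\log(n/\delta)}\Big)\ge 1-\delta.$$ (B) If $T d_{\min}>C(\log n)^3$, then for every $\delta\in(n^{-c},1/2)$, $$\mathbb P\Big(\|\mathcal L-\bar{\mathcal L}\|\le C_2(\alpha)\sqrt{\frac{\log(4n/\delta)}{T d_{\min}}}\Big)\ge 1-\delta.$$ -/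

import Mathlib

open MeasureTheory ProbabilityTheory

namespace LazyIER

/-- Adjacency matrices of undirected graphs on `[n]`: symmetric with entries in `{0, 1}`.
Self-loops (nonzero diagonal entries) are allowed. -/
def IsAdjacency {n : ℕ} (M : Matrix (Fin n) (Fin n) ℝ) : Prop :=
  M.IsSymm ∧ ∀ i j, M i j = 0 ∨ M i j = 1

/-- The potential edges `ij` with `i ≤ j`. -/
def edges (n : ℕ) : Finset (Fin n × Fin n) :=
  Finset.univ.filter fun e => e.1 ≤ e.2

/-- The mass that `Bernoulli(p)` gives to `x ∈ {0, 1}`. -/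
noncomputable def bernoulliMass (p x : ℝ) : ℝ :=
  if x = 1 then p else 1 - p

/-- The probability that an edge in state `x` moves to the state `y`: with probability `α` it
keeps its state, and with probability `1 - α` it is resampled from `Bernoulli(p)`. -/
noncomputable def lazyStep (α p x y : ℝ) : ℝ :=
  α * (if y = x then 1 else 0) + (1 - α) * bernoulliMass p y

/-- `A` is (a realization on the probability space `(Ω, μ)` of) the lazy inhomogeneous
Erdős–Rényi process with `T` layers, mean adjacency matrix `P` and laziness `α`. The layers are
indexed by `Fin T`, so that the first layer has index `0`. -/
structure IsLazyIER {n T : ℕ} {Ω : Type*} [MeasurableSpace Ω] (μ : Measure Ω)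
    (P : Matrix (Fin n) (Fin n) ℝ) (α : ℝ) (A : Fin T → Ω → Matrix (Fin n) (Fin n) ℝ) :
    Prop where
  measurable : ∀ t i j, Measurable fun ω => A t ω i j
  isAdjacency : ∀ t ω, IsAdjacency (A t ω)
  /-- In the first layer the edges are independent, with `A i j ∼ Bernoulli (P i j)`. -/
  initial : ∀ t : Fin T, (t : ℕ) = 0 → ∀ M : Matrix (Fin n) (Fin n) ℝ, IsAdjacency M →
    μ.real {ω | A t ω = M} = ∏ e ∈ edges n, bernoulliMass (P e.1 e.2) (M e.1 e.2)
  /-- Given the layers up to time `s`, the edges of the next layer `t = s + 1` are independent,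
  and each of them makes a lazy step from its state at time `s`. -/
  step : ∀ s t : Fin T, (t : ℕ) = s + 1 →
    ∀ M : Fin T → Matrix (Fin n) (Fin n) ℝ, (∀ r, IsAdjacency (M r)) →
    μ {ω | ∀ r ≤ s, A r ω = M r} ≠ 0 →
    (μ[|{ω | ∀ r ≤ s, A r ω = M r}]).real {ω | A t ω = M t} =
      ∏ e ∈ edges n, lazyStep α (P e.1 e.2) (M s e.1 e.2) (M t e.1 e.2)

/-- The operator norm of a matrix with respect to the Euclidean norm. -/
noncomputable def opNorm {n : ℕ} (M : Matrix (Fin n) (Fin n) ℝ) : ℝ :=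
  ‖Matrix.toEuclideanCLM (n := Fin n) (𝕜 := ℝ) M‖

/-- The aggregated adjacency matrix `A = ∑ₜ A⁽ᵗ⁾`. -/
def aggAdj {n T : ℕ} {Ω : Type*} (A : Fin T → Ω → Matrix (Fin n) (Fin n) ℝ) (ω : Ω) :
    Matrix (Fin n) (Fin n) ℝ :=
  ∑ t, A t ω

/-- The aggregated degree `dᵢ = ∑ₜ ∑ⱼ A⁽ᵗ⁾ᵢⱼ`. -/
def aggDegree {n T : ℕ} {Ω : Type*} (A : Fin T → Ω → Matrix (Fin n) (Fin n) ℝ) (ω : Ω)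
    (i : Fin n) : ℝ :=
  ∑ t, ∑ j, A t ω i j

/-- The population matrix `Ā = 𝔼 A`, entry by entry. -/
noncomputable def meanAdj {n T : ℕ} {Ω : Type*} [MeasurableSpace Ω] (μ : Measure Ω)
    (A : Fin T → Ω → Matrix (Fin n) (Fin n) ℝ) : Matrix (Fin n) (Fin n) ℝ :=
  Matrix.of fun i j => ∫ ω, aggAdj A ω i j ∂μ

/-- The expected aggregated degrees `d̄ᵢ = 𝔼 dᵢ`. -/
noncomputable def meanDegree {n T : ℕ} {Ω : Type*} [MeasurableSpace Ω] (μ : Measure Ω)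
    (A : Fin T → Ω → Matrix (Fin n) (Fin n) ℝ) (i : Fin n) : ℝ :=
  ∫ ω, aggDegree A ω i ∂μ

/-- `I - D^{-1/2} M D^{-1/2}` for the diagonal matrix `D` with diagonal `d`, where the entries
of `D^{-1/2}` at zero entries of `d` (isolated vertices) are `0`. -/
noncomputable def normLaplacian {n : ℕ} (M : Matrix (Fin n) (Fin n) ℝ) (d : Fin n → ℝ) :
    Matrix (Fin n) (Fin n) ℝ :=
  1 - Matrix.diagonal (fun i => (√(d i))⁻¹) * M * Matrix.diagonal (fun i => (√(d i))⁻¹)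

/-- The normalized Laplacian `𝓛` of the aggregated adjacency matrix. -/
noncomputable def aggLaplacian {n T : ℕ} {Ω : Type*}
    (A : Fin T → Ω → Matrix (Fin n) (Fin n) ℝ) (ω : Ω) : Matrix (Fin n) (Fin n) ℝ :=
  normLaplacian (aggAdj A ω) (aggDegree A ω)

/-- The population Laplacian `I - D̄^{-1/2} Ā D̄^{-1/2}`. -/
noncomputable def meanLaplacian {n T : ℕ} {Ω : Type*} [MeasurableSpace Ω] (μ : Measure Ω)
    (A : Fin T → Ω → Matrix (Fin n) (Fin n) ℝ) : Matrix (Fin n) (Fin n) ℝ :=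
  normLaplacian (meanAdj μ A) (meanDegree μ A)

/-- The maximal expected degree of a layer (for `n ≥ 1`). -/
noncomputable def dMax {n : ℕ} (P : Matrix (Fin n) (Fin n) ℝ) : ℝ :=
  ⨆ i, ∑ j, P i j

/-- The minimal expected degree of a layer (for `n ≥ 1`). -/
noncomputable def dMin {n : ℕ} (P : Matrix (Fin n) (Fin n) ℝ) : ℝ :=
  ⨅ i, ∑ j, P i j

end LazyIER

/-!
Both bounds come from a matrix Bernstein inequality for a sum `∑ e, x e • H e` of fixed symmetric
matrices with independent scalar coefficients. Here `e` runs over the potential edges, and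
`x e` is the deviation of the number of layers containing `e` from its mean. The dependence between
layers stays inside the scalars `x e`; different edges are independent.

**Scalar input.** For the two-state lazy chain of an edge with parameter `p`, the exponentially
tilted transition kernel maps `fun y => if y then c else 1` to a function bounded by a constant
multiple of a function of the same form. Iterating gives
`𝔼 exp (l x) ≤ exp (κ T p l ^ 2)` for `|l| ≤ (1 - α) / 4`, with `κ` depending on `α` only
(`sum_pathMass_mul_exp_le`). The first-order terms in `l` cancel by an exact telescoping identity.

**Matrix input.** If `𝔼 exp (l x e) ≤ exp (v e * l ^ 2)` for `|l| ≤ r` and `‖H e‖ ≤ r`, then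
diagonalizing `H e` shows that `exp (x e • H e - v e • H e ^ 2)` is at most the identity in
expectation. The Golden–Thompson inequality `trace_exp_add_le` then removes the summands one by one
from `𝔼 trace exp (∑ e, (x e • H e - v e • H e ^ 2))`, which is therefore at most `n`
(`lintegral_trace_exp_le`), and Markov's inequality gives the tail bound
`measureReal_opNorm_gt_le`. Golden–Thompson follows from the Lie product formula and the trace
inequality `trace_mul_pow_two_pow_le`.

**Adjacency matrix.** The weights `(T d_max)⁻¹` on all edges give the first bound
(`IsLazyIER.adjacency_concentration`); the hypothesis on `T d_max` puts the tail into its Gaussian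
range.

**Laplacian.** If `T d_min` is small compared to `log (4 n / δ)`, the bound is weaker than the
trivial `‖𝓛 - 𝓛̄‖ ≤ 2`. Otherwise the weights `(d̄ᵢ d̄ⱼ)^(-1/2)` control
`D̄^(-1/2) (A - Ā) D̄^(-1/2)`, diagonal weights `d̄ᵢ⁻¹` on the endpoints of each edge control all the
ratios `dᵢ / d̄ᵢ` at once, and `opNorm_normLaplacian_sub_le` combines the two
(`IsLazyIER.laplacian_concentration`).
-/

namespace LazyIER

open Matrix Filter Topology

/-! ### The Lie product formula -/

section LieProduct

theorem norm_pow_sub_pow_le {𝔸 : Type*} [NormedRing 𝔸] [NormOneClass 𝔸] {x y : 𝔸}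
    {r : ℝ} (hx : ‖x‖ ≤ r) (hy : ‖y‖ ≤ r) (m : ℕ) :
    ‖x ^ m - y ^ m‖ ≤ m * r ^ (m - 1) * ‖x - y‖ := by
  have hr : 0 ≤ r := (norm_nonneg x).trans hx
  induction m with
  | zero => simp
  | succ m ih =>
    have h : x ^ (m + 1) - y ^ (m + 1) = x ^ m * (x - y) + (x ^ m - y ^ m) * y := by
      rw [pow_succ, pow_succ]; noncomm_ring
    rw [h]
    have h1 : ‖x ^ m * (x - y)‖ ≤ r ^ m * ‖x - y‖ := by
      refine (norm_mul_le _ _).trans ?_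
      gcongr
      exact (norm_pow_le x m).trans (by gcongr)
    have h2 : ‖(x ^ m - y ^ m) * y‖ ≤ (m * r ^ (m - 1) * ‖x - y‖) * r := by
      refine (norm_mul_le _ _).trans ?_
      gcongr
    have h3 : (m * r ^ (m - 1) * ‖x - y‖) * r = m * r ^ m * ‖x - y‖ := by
      rcases m with _ | m
      · simp
      · simp [pow_succ]; ring
    refine (norm_add_le _ _).trans ?_
    rw [Nat.add_sub_cancel]
    push_cast
    linarith

variable {𝔸 : Type*} [NormedRing 𝔸] [NormOneClass 𝔸] [NormedAlgebra ℝ 𝔸] [CompleteSpace 𝔸]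

theorem norm_exp_le (x : 𝔸) : ‖NormedSpace.exp x‖ ≤ Real.exp ‖x‖ := by
  have h1 := NormedSpace.exp_series_hasSum_exp' (𝕂 := ℝ) x
  have h2 := NormedSpace.exp_series_hasSum_exp' (𝕂 := ℝ) ‖x‖
  rw [← Real.exp_eq_exp_ℝ] at h2
  rw [← h1.tsum_eq]
  refine tsum_of_norm_bounded h2 fun k => ?_
  rw [norm_smul, smul_eq_mul, Real.norm_of_nonneg (by positivity)]
  gcongr
  exact norm_pow_le x k

/-- The Lie product formula. The difference `exp (t a) exp (t b) - exp (t (a + b))` vanishes to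
first order at `t = 0`, and telescoping the `m`-th powers loses only a factor `m`. -/
theorem tendsto_exp_mul_exp_pow (a b : 𝔸) :
    Tendsto (fun m : ℕ => (NormedSpace.exp ((m : ℝ)⁻¹ • a) *
      NormedSpace.exp ((m : ℝ)⁻¹ • b)) ^ m) atTop (𝓝 (NormedSpace.exp (a + b))) := by
  let : NormedAlgebra ℚ 𝔸 := NormedAlgebra.restrictScalars ℚ ℝ 𝔸
  set f : ℝ → 𝔸 := fun t => NormedSpace.exp (t • a) * NormedSpace.exp (t • b) -
    NormedSpace.exp (t • (a + b)) with hf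
  have hd : HasDerivAt f 0 0 := by
    have h1 := hasDerivAt_exp_smul_const (𝕂 := ℝ) a 0
    have h2 := hasDerivAt_exp_smul_const (𝕂 := ℝ) b 0
    have h3 := hasDerivAt_exp_smul_const (𝕂 := ℝ) (a + b) 0
    have h4 := (h1.mul h2).sub h3
    have h5 : NormedSpace.exp ((0 : ℝ) • a) * a * NormedSpace.exp ((0 : ℝ) • b) +
        NormedSpace.exp ((0 : ℝ) • a) * (NormedSpace.exp ((0 : ℝ) • b) * b) -
        NormedSpace.exp ((0 : ℝ) • (a + b)) * (a + b) = 0 := by simp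
    rw [h5] at h4
    exact h4
  have hf0 : f 0 = 0 := by simp [hf]
  have ho : Tendsto (fun m : ℕ => (m : ℝ) * ‖f ((m : ℝ)⁻¹)‖) atTop (𝓝 0) := by
    have h1 := hd.isLittleO
    simp only [hf0, sub_zero, smul_zero] at h1
    have h2 := (h1.norm_left.comp_tendsto
      (tendsto_inv_atTop_nhds_zero_nat (𝕜 := ℝ))).tendsto_div_nhds_zero
    refine h2.congr fun m => ?_
    simp [div_eq_mul_inv, mul_comm]
  have hK : Tendsto (fun m : ℕ => Real.exp (‖a‖ + ‖b‖) * ((m : ℝ) * ‖f ((m : ℝ)⁻¹)‖)) atTop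
      (𝓝 0) := by simpa using ho.const_mul (Real.exp (‖a‖ + ‖b‖))
  rw [tendsto_iff_norm_sub_tendsto_zero]
  refine squeeze_zero' (Eventually.of_forall fun _ => norm_nonneg _) ?_ hK
  filter_upwards [eventually_gt_atTop 0] with m hm
  have hm' : (0 : ℝ) < m := by exact_mod_cast hm
  have hpow : NormedSpace.exp (a + b) = NormedSpace.exp ((m : ℝ)⁻¹ • (a + b)) ^ m := by
    rw [← NormedSpace.exp_nsmul, ← Nat.cast_smul_eq_nsmul ℝ, smul_smul,
      mul_inv_cancel₀ hm'.ne', one_smul]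
  rw [hpow]
  set r := Real.exp ((m : ℝ)⁻¹ * (‖a‖ + ‖b‖)) with hr
  have hsm : ∀ z : 𝔸, ‖(m : ℝ)⁻¹ • z‖ = (m : ℝ)⁻¹ * ‖z‖ := fun z => by
    rw [norm_smul, Real.norm_of_nonneg (by positivity)]
  have hx : ‖NormedSpace.exp ((m : ℝ)⁻¹ • a) * NormedSpace.exp ((m : ℝ)⁻¹ • b)‖ ≤ r := by
    refine (norm_mul_le _ _).trans ?_
    rw [hr, mul_add, Real.exp_add, ← hsm, ← hsm]
    gcongr <;> exact norm_exp_le _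
  have hy : ‖NormedSpace.exp ((m : ℝ)⁻¹ • (a + b))‖ ≤ r := by
    refine (norm_exp_le _).trans (Real.exp_le_exp.2 ?_)
    rw [hsm]
    gcongr
    exact norm_add_le a b
  refine (norm_pow_sub_pow_le hx hy m).trans ?_
  have h1r : 1 ≤ r := Real.one_le_exp (by positivity)
  have hrm : r ^ (m - 1) ≤ Real.exp (‖a‖ + ‖b‖) := by
    calc r ^ (m - 1) ≤ r ^ m := pow_le_pow_right₀ h1r (Nat.sub_le _ _)
      _ = Real.exp (‖a‖ + ‖b‖) := by
        rw [hr, ← Real.exp_nat_mul, ← mul_assoc, mul_inv_cancel₀ hm'.ne', one_mul]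
  calc (m : ℝ) * r ^ (m - 1) * ‖f ((m : ℝ)⁻¹)‖
      ≤ m * Real.exp (‖a‖ + ‖b‖) * ‖f ((m : ℝ)⁻¹)‖ := by gcongr
    _ = _ := by ring

end LieProduct

/-! ### The Golden–Thompson inequality -/

section GoldenThompson

theorem trace_mul_le_of_isSymm {n : Type*} [Fintype n] (P Q : Matrix n n ℝ)
    (hP : P.IsSymm) (hQ : Q.IsSymm) :
    2 * (P * Q).trace ≤ (P * P).trace + (Q * Q).trace := by
  have h : (0 : ℝ) ≤ ((P - Q) * (P - Q)).trace := by
    have hs : (P - Q)ᵀ = P - Q := by rw [transpose_sub, hP.eq, hQ.eq]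
    nth_rewrite 1 [← hs]
    simp only [trace, diag_apply, mul_apply, transpose_apply]
    exact Finset.sum_nonneg fun i _ => Finset.sum_nonneg fun j _ => mul_self_nonneg _
  have h2 : ((P - Q) * (P - Q)).trace =
      (P * P).trace + (Q * Q).trace - 2 * (P * Q).trace := by
    simp only [sub_mul, mul_sub, trace_sub]
    rw [trace_mul_comm Q P]; ring
  linarith

theorem trace_mul_self_le {n : Type*} [Fintype n] (M : Matrix n n ℝ) :
    (M * M).trace ≤ (M * Mᵀ).trace := by
  have h : (0 : ℝ) ≤ ((M - Mᵀ)ᵀ * (M - Mᵀ)).trace := by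
    simp only [trace, diag_apply, mul_apply, transpose_apply]
    exact Finset.sum_nonneg fun i _ => Finset.sum_nonneg fun j _ => mul_self_nonneg _
  have h1 : (Mᵀ * Mᵀ).trace = (M * M).trace := by
    rw [← transpose_mul, trace_transpose]
  have h2 : ((M - Mᵀ)ᵀ * (M - Mᵀ)).trace = 2 * (M * Mᵀ).trace - 2 * (M * M).trace := by
    simp only [transpose_sub, transpose_transpose, sub_mul, mul_sub, trace_sub, h1]
    rw [trace_mul_comm Mᵀ M]; ring
  linarith

variable {n : Type*} [Fintype n] [DecidableEq n]

theorem trace_mul_pow_comm (U V : Matrix n n ℝ) (k : ℕ) :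
    ((U * V) ^ k).trace = ((V * U) ^ k).trace := by
  rcases k with _ | k
  · simp
  · have h : (U * V) ^ (k + 1) = U * ((V * U) ^ k * V) := by
      induction k with
      | zero => simp
      | succ k ih =>
        rw [pow_succ, ih, pow_succ (V * U) k]
        simp only [Matrix.mul_assoc]
    rw [h, trace_mul_comm, Matrix.mul_assoc, ← pow_succ]

/-- Two trace inequalities for `2 ^ k`-th powers, proved together by induction on `k`: the second
one for `P`, `Q` is the first one for `P * Q`, and the first one for `M` reduces to the second one
for `Mᵀ * M` and `M * Mᵀ`. -/
theorem trace_pow_two_pow_le (k : ℕ) :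
    (∀ M : Matrix n n ℝ, (M ^ 2 ^ (k + 1)).trace ≤ ((M * Mᵀ) ^ 2 ^ k).trace) ∧
    ∀ P Q : Matrix n n ℝ, P.IsSymm → Q.IsSymm →
      ((P * Q) ^ 2 ^ k).trace ≤ (P ^ 2 ^ k * Q ^ 2 ^ k).trace := by
  induction k with
  | zero =>
    refine ⟨fun M => ?_, fun P Q _ _ => ?_⟩
    · simpa [sq] using trace_mul_self_le M
    · simp
  | succ k ih =>
    have hb : ∀ P Q : Matrix n n ℝ, P.IsSymm → Q.IsSymm →
        ((P * Q) ^ 2 ^ (k + 1)).trace ≤ (P ^ 2 ^ (k + 1) * Q ^ 2 ^ (k + 1)).trace := by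
      intro P Q hP hQ
      refine (ih.1 (P * Q)).trans ?_
      have h1 : (P * Q) * (P * Q)ᵀ = (P * (Q * Q)) * P := by
        rw [transpose_mul, hP.eq, hQ.eq]; simp only [Matrix.mul_assoc]
      rw [h1, trace_mul_pow_comm, ← Matrix.mul_assoc]
      refine (ih.2 (P * P) (Q * Q) ?_ ?_).trans_eq ?_
      · rw [IsSymm, transpose_mul, hP.eq]
      · rw [IsSymm, transpose_mul, hQ.eq]
      · rw [pow_succ' 2 k, pow_mul, pow_mul, sq, sq]
    refine ⟨fun M => ?_, hb⟩
    have hS1 : (Mᵀ * M).IsSymm := by rw [IsSymm, transpose_mul, transpose_transpose]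
    have hS2 : (M * Mᵀ).IsSymm := by rw [IsSymm, transpose_mul, transpose_transpose]
    have h1 : (M ^ 2 ^ (k + 1 + 1)).trace ≤ ((M * M * (M * M)ᵀ) ^ 2 ^ k).trace := by
      have := ih.1 (M * M)
      rwa [← sq, ← pow_mul, ← pow_succ', sq] at this
    have h2 : ((M * M * (M * M)ᵀ) ^ 2 ^ k).trace = (((Mᵀ * M) * (M * Mᵀ)) ^ 2 ^ k).trace := by
      have e1 : M * M * (M * M)ᵀ = (M * M * Mᵀ) * Mᵀ := by
        rw [transpose_mul]; simp only [Matrix.mul_assoc]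
      rw [e1, trace_mul_pow_comm]
      simp only [Matrix.mul_assoc]
    have h3 := ih.2 _ _ hS1 hS2
    have h4 := trace_mul_le_of_isSymm ((Mᵀ * M) ^ 2 ^ k) ((M * Mᵀ) ^ 2 ^ k)
      (hS1.pow _) (hS2.pow _)
    rw [← pow_add, ← pow_add, ← two_mul, ← pow_succ', trace_mul_pow_comm Mᵀ M] at h4
    linarith

theorem trace_mul_pow_two_pow_le {P Q : Matrix n n ℝ} (hP : P.IsSymm) (hQ : Q.IsSymm) (k : ℕ) :
    ((P * Q) ^ 2 ^ k).trace ≤ (P ^ 2 ^ k * Q ^ 2 ^ k).trace :=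
  (trace_pow_two_pow_le k).2 P Q hP hQ

attribute [local instance] Matrix.linftyOpNormedRing Matrix.linftyOpNormedAlgebra

theorem continuous_matrix_exp :
    Continuous (NormedSpace.exp : Matrix n n ℝ → Matrix n n ℝ) := by
  let : NormedAlgebra ℚ (Matrix n n ℝ) := NormedAlgebra.restrictScalars ℚ ℝ _
  exact NormedSpace.exp_continuous

/-- The Golden–Thompson inequality for real symmetric matrices. -/
theorem trace_exp_add_le {A B : Matrix n n ℝ} (hA : A.IsSymm) (hB : B.IsSymm) :
    (NormedSpace.exp (A + B)).trace ≤ (NormedSpace.exp A * NormedSpace.exp B).trace := by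
  rcases isEmpty_or_nonempty n with hn | hn
  · simp [trace]
  let : NormedAlgebra ℚ (Matrix n n ℝ) := NormedAlgebra.restrictScalars ℚ ℝ _
  have hlim := (tendsto_exp_mul_exp_pow A B).comp
    (tendsto_pow_atTop_atTop_of_one_lt (one_lt_two : 1 < 2))
  have hc : Continuous (fun M : Matrix n n ℝ => M.trace) := continuous_id.matrix_trace
  refine le_of_tendsto ((hc.tendsto _).comp hlim) (Eventually.of_forall fun k => ?_)
  have hpow : ∀ X : Matrix n n ℝ,
      NormedSpace.exp (((2 ^ k : ℕ) : ℝ)⁻¹ • X) ^ 2 ^ k = NormedSpace.exp X := fun X => by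
    rw [← Matrix.exp_nsmul, ← Nat.cast_smul_eq_nsmul ℝ, smul_smul,
      mul_inv_cancel₀ (by positivity), one_smul]
  have hsymm : ∀ X : Matrix n n ℝ, X.IsSymm →
      (NormedSpace.exp (((2 ^ k : ℕ) : ℝ)⁻¹ • X)).IsSymm := fun X hX =>
    (hX.smul _).exp
  have := trace_mul_pow_two_pow_le (hsymm A hA) (hsymm B hB) k
  rw [hpow, hpow] at this
  exact this

end GoldenThompson

/-! ### Diagonalization of real symmetric matrices -/

section Spectral

variable {n : Type*} [Fintype n] [DecidableEq n]

theorem exists_orthogonal_diagonalization {S : Matrix n n ℝ} (hS : S.IsSymm) :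
    ∃ (U : Matrix n n ℝ) (h : n → ℝ), Uᵀ * U = 1 ∧ U * Uᵀ = 1 ∧ S = U * diagonal h * Uᵀ := by
  have hS' : S.IsHermitian := by
    rw [IsHermitian, conjTranspose_eq_transpose_of_trivial, hS.eq]
  refine ⟨hS'.eigenvectorUnitary, hS'.eigenvalues, ?_, ?_, ?_⟩
  · have := Unitary.coe_star_mul_self hS'.eigenvectorUnitary
    rwa [star_eq_conjTranspose, conjTranspose_eq_transpose_of_trivial] at this
  · have := Unitary.coe_mul_star_self hS'.eigenvectorUnitary
    rwa [Unitary.coe_star, star_eq_conjTranspose, conjTranspose_eq_transpose_of_trivial] at this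
  · have := hS'.spectral_theorem
    rw [Unitary.conjStarAlgAut_apply, star_eq_conjTranspose,
      conjTranspose_eq_transpose_of_trivial] at this
    exact this

theorem exp_conj_diagonal {U : Matrix n n ℝ} (hU : U * Uᵀ = 1) (h : n → ℝ) :
    NormedSpace.exp (U * diagonal h * Uᵀ) = U * diagonal (fun k => Real.exp (h k)) * Uᵀ := by
  have hinv : U⁻¹ = Uᵀ := inv_eq_right_inv hU
  have hunit : IsUnit U := IsUnit.of_mul_eq_one _ hU
  rw [← hinv, Matrix.exp_conj _ _ hunit, Matrix.exp_diagonal]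
  congr 3
  ext k
  rw [Pi.coe_exp, Real.exp_eq_exp_ℝ]

theorem trace_mul_conj_diagonal (B U : Matrix n n ℝ) (h : n → ℝ) :
    (B * (U * diagonal h * Uᵀ)).trace = ∑ k, (Uᵀ * B * U) k k * h k := by
  rw [← Matrix.mul_assoc, ← Matrix.mul_assoc, trace_mul_comm, ← Matrix.mul_assoc,
    ← Matrix.mul_assoc]
  simp [trace, mul_diagonal]

theorem conj_exp_apply_self_nonneg {G : Matrix n n ℝ} (hG : G.IsSymm) (U : Matrix n n ℝ) (k : n) :
    0 ≤ (Uᵀ * NormedSpace.exp G * U) k k := by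
  obtain ⟨V, g, -, hV, rfl⟩ := exists_orthogonal_diagonalization hG
  rw [exp_conj_diagonal hV]
  have : Uᵀ * (V * diagonal (fun k => Real.exp (g k)) * Vᵀ) * U =
      (Vᵀ * U)ᵀ * diagonal (fun k => Real.exp (g k)) * (Vᵀ * U) := by
    rw [transpose_mul, transpose_transpose]; simp only [Matrix.mul_assoc]
  rw [this, mul_apply]
  simp only [mul_diagonal, transpose_apply]
  exact Finset.sum_nonneg fun j _ => by
    nlinarith [mul_nonneg (mul_self_nonneg ((Vᵀ * U) j k)) (Real.exp_pos (g j)).le]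

theorem dotProduct_conj_diagonal_mulVec (U : Matrix n n ℝ) (h : n → ℝ) (v : n → ℝ) :
    v ⬝ᵥ ((U * diagonal h * Uᵀ) *ᵥ v) = ∑ k, h k * (Uᵀ *ᵥ v) k ^ 2 := by
  rw [← mulVec_mulVec, ← mulVec_mulVec, dotProduct_mulVec, ← mulVec_transpose]
  simp only [dotProduct, mulVec_diagonal]
  exact Finset.sum_congr rfl fun k _ => by ring

theorem sum_sq_transpose_mulVec {U : Matrix n n ℝ} (hU : U * Uᵀ = 1) (v : n → ℝ) :
    ∑ k, (Uᵀ *ᵥ v) k ^ 2 = v ⬝ᵥ v := by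
  have := dotProduct_conj_diagonal_mulVec U (fun _ => 1) v
  simpa [hU] using this.symm

theorem mulVec_dotProduct_mulVec {n : Type*} [Fintype n] {S : Matrix n n ℝ}
    (hS : S.IsSymm) (v : n → ℝ) :
    (S *ᵥ v) ⬝ᵥ (S *ᵥ v) = v ⬝ᵥ ((S * S) *ᵥ v) := by
  rw [dotProduct_mulVec, ← mulVec_transpose, hS.eq, mulVec_mulVec, dotProduct_comm]

theorem conj_diagonal_mul_self {U : Matrix n n ℝ} (hU : Uᵀ * U = 1) (h : n → ℝ) :
    (U * diagonal h * Uᵀ) * (U * diagonal h * Uᵀ) = U * diagonal (fun k => h k ^ 2) * Uᵀ := by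
  calc _ = U * diagonal h * (Uᵀ * U) * diagonal h * Uᵀ := by simp only [Matrix.mul_assoc]
    _ = U * (diagonal h * diagonal h) * Uᵀ := by
      rw [hU, Matrix.mul_one]; simp only [Matrix.mul_assoc]
    _ = _ := by simp only [diagonal_mul_diagonal, sq]

theorem exists_eigenvector {U : Matrix n n ℝ} (hU' : Uᵀ * U = 1) (hU : U * Uᵀ = 1) (k : n) :
    ∃ v : n → ℝ, v ⬝ᵥ v = 1 ∧ ∀ h : n → ℝ, v ⬝ᵥ ((U * diagonal h * Uᵀ) *ᵥ v) = h k := by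
  have hv : Uᵀ *ᵥ (U *ᵥ Pi.single k 1) = Pi.single k 1 := by
    rw [mulVec_mulVec, hU', one_mulVec]
  refine ⟨U *ᵥ Pi.single k 1, ?_, fun h => ?_⟩
  · rw [← sum_sq_transpose_mulVec hU, hv]
    simp [Pi.single_apply]
  · rw [dotProduct_conj_diagonal_mulVec, hv]
    simp [Pi.single_apply]

/-- The exponential of a Rayleigh quotient is at most the trace of the exponential. -/
theorem exp_dotProduct_mulVec_le_trace_exp {G : Matrix n n ℝ} (hG : G.IsSymm) {v : n → ℝ}
    (hv : v ⬝ᵥ v = 1) : Real.exp (v ⬝ᵥ (G *ᵥ v)) ≤ (NormedSpace.exp G).trace := by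
  obtain ⟨U, g, hU', hU, rfl⟩ := exists_orthogonal_diagonalization hG
  have hone := sum_sq_transpose_mulVec hU v
  rw [hv] at hone
  have hk : ∃ k, v ⬝ᵥ ((U * diagonal g * Uᵀ) *ᵥ v) ≤ g k := by
    by_contra! hcon
    rw [dotProduct_conj_diagonal_mulVec] at hcon
    set r := ∑ k, g k * (Uᵀ *ᵥ v) k ^ 2 with hr
    have h1 : ∑ k, (r - g k) * (Uᵀ *ᵥ v) k ^ 2 = 0 := by
      simp only [sub_mul, Finset.sum_sub_distrib, ← Finset.mul_sum]
      rw [hone, ← hr]; ring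
    have h2 := (Finset.sum_eq_zero_iff_of_nonneg (fun k _ =>
      mul_nonneg (sub_nonneg.2 (hcon k).le) (sq_nonneg _))).1 h1
    have h3 : ∀ k, (Uᵀ *ᵥ v) k ^ 2 = 0 := fun k =>
      (mul_eq_zero.1 (h2 k (Finset.mem_univ k))).resolve_left (sub_pos.2 (hcon k)).ne'
    simp [h3] at hone
  obtain ⟨k, hk⟩ := hk
  rw [exp_conj_diagonal hU, trace_mul_comm, ← Matrix.mul_assoc, hU', Matrix.one_mul,
    trace_diagonal]
  exact (Real.exp_le_exp.2 hk).trans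
    (Finset.single_le_sum (f := fun k => Real.exp (g k)) (fun _ _ => (Real.exp_pos _).le)
      (Finset.mem_univ k))

end Spectral

/-! ### The Euclidean operator norm -/

section OpNorm

variable {n : ℕ}

theorem opNorm_le_of_forall {M : Matrix (Fin n) (Fin n) ℝ} {s : ℝ} (hs : 0 ≤ s)
    (h : ∀ v, (M *ᵥ v) ⬝ᵥ (M *ᵥ v) ≤ s ^ 2 * (v ⬝ᵥ v)) : opNorm M ≤ s := by
  refine ContinuousLinearMap.opNorm_le_bound _ hs fun x => ?_
  have hx : x = WithLp.toLp 2 x.ofLp := rfl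
  rw [hx, toEuclideanCLM_toLp, EuclideanSpace.norm_eq, EuclideanSpace.norm_eq,
    ← Real.sqrt_sq hs, ← Real.sqrt_mul (sq_nonneg s)]
  apply Real.sqrt_le_sqrt
  have := h x.ofLp
  simpa [dotProduct, sq] using this

theorem abs_apply_le_opNorm (M : Matrix (Fin n) (Fin n) ℝ) (i j : Fin n) : |M i j| ≤ opNorm M := by
  have h := (toEuclideanCLM (n := Fin n) (𝕜 := ℝ) M).le_opNorm (EuclideanSpace.single j 1)
  have h2 := PiLp.norm_apply_le
    (toEuclideanCLM (n := Fin n) (𝕜 := ℝ) M (EuclideanSpace.single j 1)) i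
  have h3 : (toEuclideanCLM (n := Fin n) (𝕜 := ℝ) M (EuclideanSpace.single j 1)).ofLp i =
      M i j := by simp
  rw [h3, Real.norm_eq_abs] at h2
  refine h2.trans (h.trans_eq ?_)
  simp [opNorm]

/-- A symmetric matrix whose norm exceeds `s` has a Rayleigh quotient above `s` or below `-s`. -/
theorem exists_rayleigh_of_lt_opNorm {S : Matrix (Fin n) (Fin n) ℝ} (hS : S.IsSymm) {s : ℝ}
    (hs : 0 ≤ s) (h : s < opNorm S) :
    ∃ v : Fin n → ℝ, v ⬝ᵥ v = 1 ∧ (s < v ⬝ᵥ (S *ᵥ v) ∨ s < v ⬝ᵥ ((-S) *ᵥ v)) := by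
  obtain ⟨U, g, hU', hU, rfl⟩ := exists_orthogonal_diagonalization hS
  have hk : ∃ k, s < |g k| := by
    by_contra! hcon
    refine absurd (opNorm_le_of_forall hs fun v => ?_) h.not_ge
    rw [mulVec_dotProduct_mulVec hS, conj_diagonal_mul_self hU', dotProduct_conj_diagonal_mulVec,
      ← sum_sq_transpose_mulVec hU, Finset.mul_sum]
    refine Finset.sum_le_sum fun k _ => mul_le_mul_of_nonneg_right ?_ (sq_nonneg _)
    exact sq_le_sq.2 ((hcon k).trans_eq (abs_of_nonneg hs).symm)
  obtain ⟨k, hk⟩ := hk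
  obtain ⟨v, hv, hvk⟩ := exists_eigenvector hU' hU k
  refine ⟨v, hv, ?_⟩
  rw [neg_mulVec, dotProduct_neg, hvk]
  exact lt_abs.1 hk

end OpNorm

/-! ### The matrix Laplace transform -/

section Chernoff

variable {Ω : Type*} [MeasurableSpace Ω] {μ : Measure Ω} {n : Type*} [Fintype n] [DecidableEq n]
  {ι : Type*}

theorem measurable_exp_sum_apply {κ : Type*} [Countable κ] (S : Finset κ)
    (H W : κ → Matrix n n ℝ) (i j : n) :
    Measurable fun x : κ → ℝ => NormedSpace.exp (∑ e ∈ S, (x e • H e - W e)) i j := by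
  refine Continuous.measurable ?_
  refine Continuous.matrix_elem (continuous_matrix_exp.comp ?_) i j
  fun_prop

theorem trace_conj {U : Matrix n n ℝ} (hU : U * Uᵀ = 1) (B : Matrix n n ℝ) :
    ∑ k, (Uᵀ * B * U) k k = B.trace := by
  have := trace_mul_conj_diagonal B U (fun _ => 1)
  simpa [hU] using this.symm

theorem smul_sub_smul_conj_diagonal {U : Matrix n n ℝ} (hU : Uᵀ * U = 1) (h : n → ℝ) (x v : ℝ) :
    x • (U * diagonal h * Uᵀ) - v • ((U * diagonal h * Uᵀ) * (U * diagonal h * Uᵀ)) =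
      U * diagonal (fun k => x * h k - v * h k ^ 2) * Uᵀ := by
  rw [conj_diagonal_mul_self hU]
  have : diagonal (fun k => x * h k - v * h k ^ 2) =
      x • diagonal h - v • diagonal (fun k => h k ^ 2) := by
    ext i j
    rcases eq_or_ne i j with rfl | hij
    · simp
    · simp [hij]
  rw [this]
  simp [Matrix.mul_sub, Matrix.sub_mul]

/-- The matrix Laplace transform bound: each summand is compensated by `v e • H e ^ 2`, which by
the scalar bound makes its exponential at most the identity in expectation, so that the
Golden–Thompson inequality peels off one summand after the other. -/
theorem lintegral_trace_exp_le [IsProbabilityMeasure μ] {x : ι → Ω → ℝ}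
    (hx : iIndepFun x μ) (hm : ∀ e, Measurable (x e)) {v : ι → ℝ} {r : ℝ} (hr : 0 ≤ r)
    (hmgf : ∀ e l, |l| ≤ r →
      ∫⁻ ω, ENNReal.ofReal (Real.exp (l * x e ω)) ∂μ ≤ ENNReal.ofReal (Real.exp (v e * l ^ 2)))
    {H : ι → Matrix n n ℝ} (hH : ∀ e, (H e).IsSymm)
    (hHr : ∀ e ξ, (H e *ᵥ ξ) ⬝ᵥ (H e *ᵥ ξ) ≤ r ^ 2 * (ξ ⬝ᵥ ξ)) (S : Finset ι) :
    ∫⁻ ω, ENNReal.ofReal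
      (NormedSpace.exp (∑ e ∈ S, (x e ω • H e - v e • (H e * H e)))).trace ∂μ ≤
      Fintype.card n := by
  classical
  induction S using Finset.induction_on with
  | empty =>
    simp
  | insert e S he ih =>
    obtain ⟨U, h, hU', hU, hHe⟩ := exists_orthogonal_diagonalization (hH e)
    have hsymm : ∀ e ω, (x e ω • H e - v e • (H e * H e)).IsSymm := fun e ω => by
      have h2 : (H e * H e).IsSymm := by rw [IsSymm, transpose_mul, (hH e).eq]
      exact ((hH e).smul _).sub (h2.smul _)
    have hsymmS : ∀ ω, (∑ e ∈ S, (x e ω • H e - v e • (H e * H e))).IsSymm := fun ω => by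
      rw [IsSymm, transpose_sum]
      exact Finset.sum_congr rfl fun e _ => (hsymm e ω).eq
    have hhr : ∀ k, |h k| ≤ r := fun k => by
      obtain ⟨w, hw, hwk⟩ := exists_eigenvector hU' hU k
      have h1 := hHr e w
      rw [mulVec_dotProduct_mulVec (hH e), hHe, conj_diagonal_mul_self hU', hwk, hw, mul_one] at h1
      exact abs_le_of_sq_le_sq' h1 hr |> abs_le.2
    set q : Ω → n → ℝ := fun ω k =>
      (Uᵀ * NormedSpace.exp (∑ e ∈ S, (x e ω • H e - v e • (H e * H e))) * U) k k with hq
    have hq0 : ∀ ω k, 0 ≤ q ω k := fun ω k => conj_exp_apply_self_nonneg (hsymmS ω) U k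
    set F : n → ((i : S) → ℝ) → ℝ := fun k y =>
      (Uᵀ * NormedSpace.exp (∑ i : S, (y i • H i - v i • (H i * H i))) * U) k k with hF
    have hqF : ∀ ω k, q ω k = F k (fun i : S => x i ω) := fun ω k => by
      simp only [hq, hF]
      rw [← Finset.sum_coe_sort S]
    have hFm : ∀ k, Measurable (F k) := fun k => by
      simp only [hF, mul_apply, Finset.sum_mul]
      refine Finset.measurable_sum _ fun i _ => Finset.measurable_sum _ fun j _ => ?_
      exact ((measurable_exp_sum_apply Finset.univ (fun i : S => H i)
        (fun i : S => v i • (H i * H i)) j i).const_mul _).mul_const _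
    have hqm : ∀ k, Measurable fun ω => q ω k := fun k => by
      simp only [hqF]
      exact (hFm k).comp (measurable_pi_lambda _ fun i => hm i)
    have hind : ∀ k, IndepFun (fun ω => ENNReal.ofReal (q ω k))
        (fun ω => ENNReal.ofReal (Real.exp (x e ω * h k - v e * h k ^ 2))) μ := fun k => by
      have h1 := hx.indepFun_finset S {e} (by simpa using he) hm
      have h2 := h1.comp (φ := fun y => ENNReal.ofReal (F k y))
        (ψ := fun y : (({e} : Finset ι) → ℝ) => ENNReal.ofReal
          (Real.exp (y ⟨e, Finset.mem_singleton_self e⟩ * h k - v e * h k ^ 2)))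
        (hFm k).ennreal_ofReal (by fun_prop)
      simp only [hqF]
      exact h2
    have hone : ∀ k,
        ∫⁻ ω, ENNReal.ofReal (Real.exp (x e ω * h k - v e * h k ^ 2)) ∂μ ≤ 1 := fun k => by
      have h1 : ∀ ω, ENNReal.ofReal (Real.exp (x e ω * h k - v e * h k ^ 2)) =
          ENNReal.ofReal (Real.exp (h k * x e ω)) *
            ENNReal.ofReal (Real.exp (-(v e * h k ^ 2))) := fun ω => by
        rw [← ENNReal.ofReal_mul (Real.exp_pos _).le, ← Real.exp_add]
        congr 2; ring
      simp only [h1]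
      rw [lintegral_mul_const' _ _ ENNReal.ofReal_ne_top]
      calc _ ≤ ENNReal.ofReal (Real.exp (v e * h k ^ 2)) *
            ENNReal.ofReal (Real.exp (-(v e * h k ^ 2))) := by
            gcongr
            exact hmgf e _ (hhr k)
        _ = 1 := by
          rw [← ENNReal.ofReal_mul (Real.exp_pos _).le, ← Real.exp_add]; simp
    calc ∫⁻ ω, ENNReal.ofReal (NormedSpace.exp
            (∑ e ∈ insert e S, (x e ω • H e - v e • (H e * H e)))).trace ∂μ
        ≤ ∫⁻ ω, ∑ k, ENNReal.ofReal (q ω k) *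
            ENNReal.ofReal (Real.exp (x e ω * h k - v e * h k ^ 2)) ∂μ := by
          refine lintegral_mono fun ω => ?_
          have h1 := trace_exp_add_le (hsymmS ω) (hsymm e ω)
          have h2 : x e ω • H e - v e • (H e * H e) =
              U * diagonal (fun k => x e ω * h k - v e * h k ^ 2) * Uᵀ := by
            rw [hHe]; exact smul_sub_smul_conj_diagonal hU' h _ _
          rw [Finset.sum_insert he, add_comm]
          refine (ENNReal.ofReal_le_ofReal h1).trans_eq ?_
          rw [h2, exp_conj_diagonal hU, trace_mul_conj_diagonal, ENNReal.ofReal_sum_of_nonneg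
            fun k _ => mul_nonneg (hq0 ω k) (Real.exp_pos _).le]
          exact Finset.sum_congr rfl fun k _ => ENNReal.ofReal_mul (hq0 ω k)
      _ = ∑ k, (∫⁻ ω, ENNReal.ofReal (q ω k) ∂μ) *
            ∫⁻ ω, ENNReal.ofReal (Real.exp (x e ω * h k - v e * h k ^ 2)) ∂μ := by
          have hxe := hm e
          have hmul : ∀ k ∈ (Finset.univ : Finset n), Measurable fun ω => ENNReal.ofReal (q ω k) *
              ENNReal.ofReal (Real.exp (x e ω * h k - v e * h k ^ 2)) := fun k _ =>
            (hqm k).ennreal_ofReal.mul (by fun_prop)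
          rw [lintegral_finsetSum _ hmul]
          exact Finset.sum_congr rfl fun k _ =>
            lintegral_mul_eq_lintegral_mul_lintegral_of_indepFun
              (hqm k).ennreal_ofReal (by fun_prop) (hind k)
      _ ≤ ∑ k, ∫⁻ ω, ENNReal.ofReal (q ω k) ∂μ :=
          Finset.sum_le_sum fun k _ => mul_le_of_le_one_right' (hone k)
      _ = ∫⁻ ω, ENNReal.ofReal (NormedSpace.exp
            (∑ e ∈ S, (x e ω • H e - v e • (H e * H e)))).trace ∂μ := by
          rw [← lintegral_finsetSum _ fun k _ => (hqm k).ennreal_ofReal]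
          refine lintegral_congr fun ω => ?_
          rw [← trace_conj hU, ENNReal.ofReal_sum_of_nonneg fun k _ => hq0 ω k]
      _ ≤ Fintype.card n := ih

end Chernoff

/-! ### Tail bounds for matrix sums -/

section Tail

variable {Ω : Type*} [MeasurableSpace Ω] {μ : Measure Ω} {n : ℕ} {ι : Type*} [Fintype ι]

/-- The one-sided tail bound. The parameter `θ` is the argument of the Laplace transform; the
compensating term `θ ^ 2 • ∑ e, v e • H e ^ 2` is bounded through its quadratic form only. -/
theorem measure_rayleigh_gt_le [IsProbabilityMeasure μ] {x : ι → Ω → ℝ}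
    (hx : iIndepFun x μ) (hm : ∀ e, Measurable (x e)) {v : ι → ℝ} {r : ℝ} (hr : 0 ≤ r)
    (hmgf : ∀ e l, |l| ≤ r →
      ∫⁻ ω, ENNReal.ofReal (Real.exp (l * x e ω)) ∂μ ≤ ENNReal.ofReal (Real.exp (v e * l ^ 2)))
    {H : ι → Matrix (Fin n) (Fin n) ℝ} (hH : ∀ e, (H e).IsSymm) {R σ θ : ℝ} (hθ : 0 ≤ θ)
    (hHR : ∀ e ξ, (H e *ᵥ ξ) ⬝ᵥ (H e *ᵥ ξ) ≤ R ^ 2 * (ξ ⬝ᵥ ξ)) (hR : 0 ≤ R) (hθR : θ * R ≤ r)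
    (hσ : ∀ ξ, ∑ e, v e * ((H e *ᵥ ξ) ⬝ᵥ (H e *ᵥ ξ)) ≤ σ * (ξ ⬝ᵥ ξ)) (s : ℝ) :
    μ {ω | ∃ ξ : Fin n → ℝ, ξ ⬝ᵥ ξ = 1 ∧ s < ξ ⬝ᵥ ((∑ e, x e ω • H e) *ᵥ ξ)} ≤
      ENNReal.ofReal (n * Real.exp (σ * θ ^ 2 - θ * s)) := by
  have hsymm : ∀ e ω, (x e ω • (θ • H e) - v e • ((θ • H e) * (θ • H e))).IsSymm := fun e ω => by
    have h2 : ((θ • H e) * (θ • H e)).IsSymm := by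
      rw [IsSymm, transpose_mul, ((hH e).smul θ).eq]
    exact (((hH e).smul _).smul _).sub (h2.smul _)
  set Y : Ω → Matrix (Fin n) (Fin n) ℝ := fun ω =>
    ∑ e, (x e ω • (θ • H e) - v e • ((θ • H e) * (θ • H e))) with hY
  have hYs : ∀ ω, (Y ω).IsSymm := fun ω => by
    rw [IsSymm, hY, transpose_sum]
    exact Finset.sum_congr rfl fun e _ => (hsymm e ω).eq
  have hlin := lintegral_trace_exp_le hx hm hr hmgf (H := fun e => θ • H e)
    (fun e => (hH e).smul θ) (fun e ξ => by
      rw [smul_mulVec, smul_dotProduct, dotProduct_smul, smul_eq_mul, smul_eq_mul]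
      calc θ * (θ * ((H e *ᵥ ξ) ⬝ᵥ (H e *ᵥ ξ))) ≤ θ * (θ * (R ^ 2 * (ξ ⬝ᵥ ξ))) := by
            gcongr; exact hHR e ξ
        _ = (θ * R) ^ 2 * (ξ ⬝ᵥ ξ) := by ring
        _ ≤ r ^ 2 * (ξ ⬝ᵥ ξ) := by
            gcongr
            exact Finset.sum_nonneg fun i _ => mul_self_nonneg _) Finset.univ
  have hquad : ∀ ω (ξ : Fin n → ℝ), ξ ⬝ᵥ (Y ω *ᵥ ξ) = θ * (ξ ⬝ᵥ ((∑ e, x e ω • H e) *ᵥ ξ)) -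
      θ ^ 2 * ∑ e, v e * ((H e *ᵥ ξ) ⬝ᵥ (H e *ᵥ ξ)) := fun ω ξ => by
    simp only [hY, sum_mulVec, dotProduct_sum, Finset.mul_sum, ← Finset.sum_sub_distrib]
    refine Finset.sum_congr rfl fun e _ => ?_
    rw [mulVec_dotProduct_mulVec (hH e)]
    simp only [sub_mulVec, smul_mulVec, dotProduct_sub, dotProduct_smul, smul_eq_mul,
      Matrix.smul_mul, Matrix.mul_smul]
    ring
  set c := ENNReal.ofReal (Real.exp (θ * s - σ * θ ^ 2)) with hc
  have hsub : {ω | ∃ ξ : Fin n → ℝ, ξ ⬝ᵥ ξ = 1 ∧ s < ξ ⬝ᵥ ((∑ e, x e ω • H e) *ᵥ ξ)} ⊆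
      {ω | c ≤ ENNReal.ofReal (NormedSpace.exp (Y ω)).trace} := by
    rintro ω ⟨ξ, hξ, hs⟩
    refine ENNReal.ofReal_le_ofReal
      (le_trans (Real.exp_le_exp.2 ?_) (exp_dotProduct_mulVec_le_trace_exp (hYs ω) hξ))
    rw [hquad]
    have h1 := hσ ξ
    rw [hξ, mul_one] at h1
    nlinarith [mul_le_mul_of_nonneg_left h1 (sq_nonneg θ), mul_le_mul_of_nonneg_left hs.le hθ]
  have hYm : Measurable fun ω => ENNReal.ofReal (NormedSpace.exp (Y ω)).trace := by
    refine Measurable.ennreal_ofReal ?_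
    simp only [trace, diag_apply]
    refine Finset.measurable_sum _ fun i _ => ?_
    exact (measurable_exp_sum_apply Finset.univ (fun e => θ • H e)
      (fun e => v e • ((θ • H e) * (θ • H e))) i i).comp (measurable_pi_lambda _ hm)
  have hmark := (mul_meas_ge_le_lintegral₀ (μ := μ) hYm.aemeasurable c).trans hlin
  rw [Fintype.card_fin] at hmark
  have hinv : ENNReal.ofReal (Real.exp (σ * θ ^ 2 - θ * s)) * c = 1 := by
    rw [hc, ← ENNReal.ofReal_mul (Real.exp_pos _).le, ← Real.exp_add]; simp
  calc _ ≤ μ {ω | c ≤ ENNReal.ofReal (NormedSpace.exp (Y ω)).trace} := measure_mono hsub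
    _ = ENNReal.ofReal (Real.exp (σ * θ ^ 2 - θ * s)) *
        (c * μ {ω | c ≤ ENNReal.ofReal (NormedSpace.exp (Y ω)).trace}) := by
      rw [← mul_assoc, hinv, one_mul]
    _ ≤ ENNReal.ofReal (Real.exp (σ * θ ^ 2 - θ * s)) * n := by gcongr
    _ = _ := by
      rw [ENNReal.ofReal_mul (Nat.cast_nonneg n), ENNReal.ofReal_natCast, mul_comm]

/-- A Bernstein-type tail bound for the operator norm of a sum of fixed symmetric matrices with
independent scalar coefficients. The entries of the sum need not be bounded: only the moment
generating functions of the coefficients near `0` enter. -/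
theorem measureReal_opNorm_gt_le [IsProbabilityMeasure μ] {x : ι → Ω → ℝ}
    (hx : iIndepFun x μ) (hm : ∀ e, Measurable (x e)) {v : ι → ℝ} {r : ℝ} (hr : 0 ≤ r)
    (hmgf : ∀ e l, |l| ≤ r →
      ∫⁻ ω, ENNReal.ofReal (Real.exp (l * x e ω)) ∂μ ≤ ENNReal.ofReal (Real.exp (v e * l ^ 2)))
    {H : ι → Matrix (Fin n) (Fin n) ℝ} (hH : ∀ e, (H e).IsSymm) {R σ θ : ℝ} (hθ : 0 ≤ θ)
    (hHR : ∀ e ξ, (H e *ᵥ ξ) ⬝ᵥ (H e *ᵥ ξ) ≤ R ^ 2 * (ξ ⬝ᵥ ξ)) (hR : 0 ≤ R) (hθR : θ * R ≤ r)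
    (hσ : ∀ ξ, ∑ e, v e * ((H e *ᵥ ξ) ⬝ᵥ (H e *ᵥ ξ)) ≤ σ * (ξ ⬝ᵥ ξ)) {s : ℝ} (hs : 0 ≤ s) :
    μ.real {ω | s < opNorm (∑ e, x e ω • H e)} ≤
      2 * n * Real.exp (σ * θ ^ 2 - θ * s) := by
  have h1 := measure_rayleigh_gt_le hx hm hr hmgf hH hθ hHR hR hθR hσ s
  have h2 := measure_rayleigh_gt_le hx hm hr hmgf (fun e => (hH e).neg) hθ
    (fun e ξ => by simpa [neg_mulVec] using hHR e ξ) hR hθR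
    (fun ξ => by simpa [neg_mulVec] using hσ ξ) s
  have hsub : {ω | s < opNorm (∑ e, x e ω • H e)} ⊆
      {ω | ∃ ξ : Fin n → ℝ, ξ ⬝ᵥ ξ = 1 ∧ s < ξ ⬝ᵥ ((∑ e, x e ω • H e) *ᵥ ξ)} ∪
      {ω | ∃ ξ : Fin n → ℝ, ξ ⬝ᵥ ξ = 1 ∧ s < ξ ⬝ᵥ ((∑ e, x e ω • -H e) *ᵥ ξ)} := by
    intro ω hω
    have hS : (∑ e, x e ω • H e).IsSymm := by
      rw [IsSymm, transpose_sum]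
      exact Finset.sum_congr rfl fun e _ => ((hH e).smul _).eq
    obtain ⟨ξ, hξ, h | h⟩ := exists_rayleigh_of_lt_opNorm hS hs hω
    · exact Or.inl ⟨ξ, hξ, h⟩
    · refine Or.inr ⟨ξ, hξ, ?_⟩
      simpa only [smul_neg, Finset.sum_neg_distrib] using h
  refine ENNReal.toReal_le_of_le_ofReal (by positivity) ?_
  calc _ ≤ _ := measure_mono hsub
    _ ≤ _ := measure_union_le _ _
    _ ≤ _ := add_le_add h1 h2
    _ = _ := by
      rw [← ENNReal.ofReal_add (by positivity) (by positivity)]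
      congr 1; ring

end Tail

/-! ### The moment generating function of the lazy two-state chain -/

section Chain

/-- The state `0` or `1` of an edge as a real number. -/
def edgeValue (b : Bool) : ℝ := if b then 1 else 0

/-- The probability that an edge with parameter `p` runs through the states `y` in the first
`k + 1` layers. -/
noncomputable def pathMass (α p : ℝ) : (k : ℕ) → (Fin (k + 1) → Bool) → ℝ
  | 0, y => bernoulliMass p (edgeValue (y 0))
  | k + 1, y => pathMass α p k (fun i => y i.castSucc) *
      lazyStep α p (edgeValue (y (Fin.last k).castSucc)) (edgeValue (y (Fin.last (k + 1))))

theorem sum_path_succ {k : ℕ} (g : (Fin (k + 2) → Bool) → ℝ) :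
    ∑ y, g y = ∑ y : Fin (k + 1) → Bool,
      ∑ b : Bool, g (Fin.snoc (α := fun _ => Bool) y b) := by
  rw [← (Fin.snocEquiv (n := k + 1) fun _ => Bool).sum_comp, Fintype.sum_prod_type_right]
  rfl

theorem bernoulliMass_nonneg {p : ℝ} (hp : p ∈ Set.Icc (0 : ℝ) 1) (x : ℝ) :
    0 ≤ bernoulliMass p x := by
  unfold bernoulliMass
  split_ifs
  · exact hp.1
  · exact sub_nonneg.2 hp.2

theorem lazyStep_nonneg {α p : ℝ} (hα : α ∈ Set.Ioo (0 : ℝ) 1) (hp : p ∈ Set.Icc (0 : ℝ) 1)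
    (x y : ℝ) : 0 ≤ lazyStep α p x y := by
  unfold lazyStep
  have h1 := bernoulliMass_nonneg hp y
  have h2 := hα.1.le
  have h3 := sub_nonneg.2 hα.2.le
  split_ifs <;> positivity

theorem pathMass_nonneg {α p : ℝ} (hα : α ∈ Set.Ioo (0 : ℝ) 1) (hp : p ∈ Set.Icc (0 : ℝ) 1)
    (k : ℕ) (y : Fin (k + 1) → Bool) : 0 ≤ pathMass α p k y := by
  induction k with
  | zero => exact bernoulliMass_nonneg hp _
  | succ k ih => exact mul_nonneg (ih _) (lazyStep_nonneg hα hp _ _)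

theorem sum_pathMass (α p : ℝ) (k : ℕ) : ∑ y, pathMass α p k y = 1 := by
  induction k with
  | zero =>
    rw [← (Equiv.funUnique (Fin 1) Bool).symm.sum_comp]
    simp [pathMass, bernoulliMass, edgeValue]
  | succ k ih =>
    rw [sum_path_succ, ← ih]
    refine Finset.sum_congr rfl fun y _ => ?_
    simp only [pathMass, Fin.snoc_castSucc, Fin.snoc_last, ← Finset.mul_sum]
    have : ∀ x : Bool, ∑ b : Bool, lazyStep α p (edgeValue x) (edgeValue b) = 1 := fun x => by
      cases x <;> simp [lazyStep, bernoulliMass, edgeValue] <;> ring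
    rw [this, mul_one]

/-- The expectation of `exp (l * ∑ i, (y i - p)) * f (y k)` over the paths `y` of an edge. -/
noncomputable def pathExp (α p l : ℝ) (k : ℕ) (f : Bool → ℝ) : ℝ :=
  ∑ y : Fin (k + 1) → Bool,
    pathMass α p k y * (Real.exp (l * ∑ i, (edgeValue (y i) - p)) * f (y (Fin.last k)))

theorem pathExp_succ (α p l : ℝ) (k : ℕ) (f : Bool → ℝ) :
    pathExp α p l (k + 1) f = pathExp α p l k fun x => ∑ b : Bool,
      lazyStep α p (edgeValue x) (edgeValue b) * Real.exp (l * (edgeValue b - p)) * f b := by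
  unfold pathExp
  rw [sum_path_succ]
  refine Finset.sum_congr rfl fun y _ => ?_
  simp only [pathMass, Fin.sum_univ_castSucc (n := k + 1), Fin.snoc_castSucc, Fin.snoc_last,
    Finset.mul_sum, mul_add, Real.exp_add]
  exact Finset.sum_congr rfl fun b _ => by ring

theorem pathExp_mono {α p : ℝ} (hα : α ∈ Set.Ioo (0 : ℝ) 1) (hp : p ∈ Set.Icc (0 : ℝ) 1)
    (l : ℝ) (k : ℕ) {f g : Bool → ℝ} (h : ∀ b, f b ≤ g b) :
    pathExp α p l k f ≤ pathExp α p l k g :=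
  Finset.sum_le_sum fun y _ => mul_le_mul_of_nonneg_left
    (mul_le_mul_of_nonneg_left (h _) (Real.exp_pos _).le) (pathMass_nonneg hα hp k y)

/-- The weights `c j` on state `1` for which the exponentially tilted transition kernel maps
`fun b => if b then c j else 1` below a constant multiple of the same function for `j + 1`: `c j`
is the factor by which starting in state `1` and not in state `0` changes the expected value of the
exponential of `l` times the time spent in state `1` during `j` steps until the first
resampling. -/
noncomputable def tiltWeight (α l : ℝ) : ℕ → ℝ
  | 0 => 1
  | j + 1 => 1 + α * (Real.exp l * tiltWeight α l j - 1)

theorem tiltWeight_pos {α : ℝ} (hα : α ∈ Set.Ioo (0 : ℝ) 1) (l : ℝ) (j : ℕ) :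
    0 < tiltWeight α l j := by
  induction j with
  | zero => simp [tiltWeight]
  | succ j ih =>
    rw [tiltWeight]
    nlinarith [mul_pos hα.1 (mul_pos (Real.exp_pos l) ih), hα.2]

theorem exp_mul_edgeValue_sub (l p : ℝ) (b : Bool) :
    Real.exp (l * (edgeValue b - p)) = Real.exp (-(l * p)) * (if b then Real.exp l else 1) := by
  cases b
  · simp [edgeValue]
  · simp only [edgeValue, if_true, ← Real.exp_add]
    congr 1; ring

/-- One layer of the tilted chain replaces the weight on state `1` by the next one at the cost of a
factor `exp (p * (-l + (1 - α) * (exp l * tiltWeight α l j - 1)))`, the contribution of fresh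
draws; the first layer is a fresh draw with probability `1`. -/
theorem pathExp_tiltWeight_le {α p : ℝ} (hα : α ∈ Set.Ioo (0 : ℝ) 1)
    (hp : p ∈ Set.Icc (0 : ℝ) 1) (l : ℝ) (k j : ℕ) :
    pathExp α p l k (fun b => if b then tiltWeight α l j else 1) ≤
      Real.exp (p * (-(l * (k + 1)) +
        (1 - α) * ∑ i ∈ Finset.range k, (Real.exp l * tiltWeight α l (j + i) - 1) +
        (Real.exp l * tiltWeight α l (j + k) - 1))) := by
  induction k generalizing j with
  | zero =>
    have h1 : pathExp α p l 0 (fun b => if b then tiltWeight α l j else 1) =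
        Real.exp (-(l * p)) * (p * (Real.exp l * tiltWeight α l j - 1) + 1) := by
      have h2 : ∀ y : Fin (0 + 1) → Bool, Real.exp (l * ∑ i, (edgeValue (y i) - p)) =
          Real.exp (-(l * p)) * (if y 0 then Real.exp l else 1) := fun y => by
        rw [← exp_mul_edgeValue_sub]; simp
      unfold pathExp
      simp only [h2]
      rw [← (Equiv.funUnique (Fin 1) Bool).symm.sum_comp]
      simp [pathMass, bernoulliMass, edgeValue]
      ring
    rw [h1]
    refine (mul_le_mul_of_nonneg_left (Real.add_one_le_exp _) (Real.exp_pos _).le).trans_eq ?_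
    rw [← Real.exp_add]
    congr 1
    simp
    ring
  | succ k ih =>
    set s := Real.exp l * tiltWeight α l j - 1 with hs
    set E := Real.exp (p * (-l + (1 - α) * s)) with hE
    have hstep : ∀ x : Bool, (∑ b : Bool, lazyStep α p (edgeValue x) (edgeValue b) *
        Real.exp (l * (edgeValue b - p)) * (if b then tiltWeight α l j else 1)) ≤
        E * (if x then tiltWeight α l (j + 1) else 1) := by
      intro x
      set G := (1 - α) * p * s with hG
      have hE' : E = Real.exp (-(l * p)) * Real.exp G := by
        rw [hE, ← Real.exp_add]; congr 1; rw [hG]; ring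
      have hGe := Real.add_one_le_exp G
      have hsum : (∑ b : Bool, lazyStep α p (edgeValue x) (edgeValue b) *
        Real.exp (l * (edgeValue b - p)) * (if b then tiltWeight α l j else 1)) =
          Real.exp (-(l * p)) * ((if x then tiltWeight α l (j + 1) else 1) + G) := by
        simp only [exp_mul_edgeValue_sub]
        cases x <;>
        · simp [lazyStep, bernoulliMass, edgeValue, tiltWeight, hG, hs]
          ring
      rw [hsum, hE', mul_assoc]
      refine mul_le_mul_of_nonneg_left ?_ (Real.exp_pos _).le
      cases x
      · simpa [add_comm] using hGe
      · have hc := tiltWeight_pos hα l (j + 1)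
        -- `tiltWeight α l (j + 1) - 1 = α * s` has the sign of `G`
        have hsg : 0 ≤ (tiltWeight α l (j + 1) - 1) * G := by
          have : (tiltWeight α l (j + 1) - 1) * G = α * ((1 - α) * p) * (s * s) := by
            rw [tiltWeight, hG]; ring
          rw [this]
          have h1 := hα.1.le
          have h2 := sub_nonneg.2 hα.2.le
          have h3 := hp.1
          have h4 := mul_self_nonneg s
          positivity
        simp only [if_true]
        nlinarith [mul_le_mul_of_nonneg_left hGe hc.le]
    rw [pathExp_succ]
    refine (pathExp_mono hα hp l k hstep).trans ?_
    have hlin : pathExp α p l k (fun x => E * (if x then tiltWeight α l (j + 1) else 1)) =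
        E * pathExp α p l k (fun x => if x then tiltWeight α l (j + 1) else 1) := by
      unfold pathExp
      rw [Finset.mul_sum]
      exact Finset.sum_congr rfl fun y _ => by ring
    rw [hlin]
    refine (mul_le_mul_of_nonneg_left (ih (j + 1)) (Real.exp_pos _).le).trans_eq ?_
    rw [← Real.exp_add, Finset.sum_range_succ']
    congr 1
    have e1 : ∀ i, j + 1 + i = j + (i + 1) := fun i => by ring
    simp only [e1, add_zero, ← hs]
    push_cast
    ring

/-- The constant in front of the variance proxy of the time an edge spends in state `1`. -/
noncomputable def lazyConst (α : ℝ) : ℝ := 1 + 8 / (1 - α)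

/-- The number of layers in which an edge is present has, after centering, a Gaussian moment
generating function near `0`, with variance proxy proportional to the number of layers and
to `p`. -/
theorem sum_pathMass_mul_exp_le {α p : ℝ} (hα : α ∈ Set.Ioo (0 : ℝ) 1)
    (hp : p ∈ Set.Icc (0 : ℝ) 1) {l : ℝ} (hl : |l| ≤ (1 - α) / 4) (k : ℕ) :
    ∑ y : Fin (k + 1) → Bool,
      pathMass α p k y * Real.exp (l * ∑ i, (edgeValue (y i) - p)) ≤
      Real.exp (lazyConst α * (k + 1) * p * l ^ 2) := by
  have hα1 : 0 < 1 - α := sub_pos.2 hα.2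
  have h1 := pathExp_tiltWeight_le hα hp l k 0
  have h0 : pathExp α p l k (fun b => if b then tiltWeight α l 0 else 1) =
      ∑ y : Fin (k + 1) → Bool,
        pathMass α p k y * Real.exp (l * ∑ i, (edgeValue (y i) - p)) := by
    simp [pathExp, tiltWeight]
  rw [← h0]
  refine h1.trans (Real.exp_le_exp.2 ?_)
  simp only [zero_add]
  set s : ℕ → ℝ := fun i => Real.exp l * tiltWeight α l i - 1 with hs
  have hs0 : s 0 = Real.exp l - 1 := by simp [hs, tiltWeight]
  have hsucc : ∀ i, s (i + 1) = Real.exp l * (1 + α * s i) - 1 := fun i => by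
    simp [hs, tiltWeight]
  have hl1 : |l| ≤ 1 := by linarith [hα.1]
  have he1 := Real.abs_exp_sub_one_le hl1
  have he2 := (abs_le.1 (Real.abs_exp_sub_one_sub_id_le hl1)).2
  set u := Real.exp l - 1 with hu
  have hexp : Real.exp l = 1 + u := by rw [hu]; ring
  -- this identity makes the terms of first order in `l` cancel
  have htel : ∀ k : ℕ, (1 - α) * ∑ i ∈ Finset.range k, s i + s k =
      (k + 1) * u + α * u * ∑ i ∈ Finset.range k, s i := by
    intro k
    induction k with
    | zero => simp [hs0]
    | succ k ih =>
      have := hsucc k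
      rw [hexp] at this
      rw [Finset.sum_range_succ, this]
      push_cast
      linear_combination ih
  have hu4 : |u| ≤ (1 - α) / 2 := by linarith
  have hsb : ∀ i, |s i| ≤ 2 * |u| / (1 - α) := by
    intro i
    induction i with
    | zero =>
      rw [hs0, le_div_iff₀ hα1]
      nlinarith [abs_nonneg u, hα.1]
    | succ i ih =>
      have h2 : s (i + 1) = α * (1 + u) * s i + u := by rw [hsucc, hexp]; ring
      have h3 : |α * (1 + u) * s i| ≤ (1 + α) / 2 * |s i| := by
        rw [abs_mul]
        refine mul_le_mul_of_nonneg_right ?_ (abs_nonneg _)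
        rw [abs_le]
        have h4 := abs_le.1 hu4
        constructor <;> nlinarith [hα.1, hα.2]
      rw [h2]
      refine (abs_add_le _ _).trans ?_
      have h5 : (1 + α) / 2 * |s i| ≤ (1 + α) / 2 * (2 * |u| / (1 - α)) :=
        mul_le_mul_of_nonneg_left ih (by linarith [hα.1])
      have h6 : (1 + α) / 2 * (2 * |u| / (1 - α)) + |u| = 2 * |u| / (1 - α) := by
        field_simp; ring
      linarith
  have hsum : α * u * ∑ i ∈ Finset.range k, s i ≤ (k + 1) * (8 / (1 - α) * l ^ 2) := by
    have h2 : |∑ i ∈ Finset.range k, s i| ≤ k * (2 * |u| / (1 - α)) := by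
      refine (Finset.abs_sum_le_sum_abs _ _).trans ?_
      refine (Finset.sum_le_sum fun i _ => hsb i).trans_eq ?_
      simp
    calc α * u * ∑ i ∈ Finset.range k, s i ≤ |α * u * ∑ i ∈ Finset.range k, s i| := le_abs_self _
      _ = α * |u| * |∑ i ∈ Finset.range k, s i| := by
        rw [abs_mul, abs_mul, abs_of_pos hα.1]
      _ ≤ 1 * (2 * |l|) * ((k + 1) * (2 * (2 * |l|) / (1 - α))) := by
        gcongr
        · exact hα.2.le
        · refine h2.trans ?_
          gcongr
          linarith
      _ = (k + 1) * (8 / (1 - α) * |l| ^ 2) := by field_simp; ring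
      _ = _ := by rw [sq_abs]
  have hk := htel k
  have hk1 : (0 : ℝ) < k + 1 := by positivity
  calc p * (-(l * (k + 1)) + (1 - α) * ∑ i ∈ Finset.range k, s i + s k)
      = p * ((k + 1) * (u - l) + α * u * ∑ i ∈ Finset.range k, s i) := by
        rw [add_assoc, hk]; ring
    _ ≤ p * ((k + 1) * l ^ 2 + (k + 1) * (8 / (1 - α) * l ^ 2)) := by
        have := hp.1
        gcongr
    _ = _ := by unfold lazyConst; ring

end Chain

/-! ### Potential edges -/

section Edges

variable {n : ℕ}

/-- The potential edge between `a` and `b`. -/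
def edgeOf (a b : Fin n) : {e // e ∈ edges n} :=
  ⟨(min a b, max a b), by simp [edges]⟩

theorem edgeOf_comm (a b : Fin n) : edgeOf a b = edgeOf b a := by
  simp [edgeOf, min_comm, max_comm]

theorem edgeOf_fst_snd (e : {e // e ∈ edges n}) : edgeOf e.1.1 e.1.2 = e := by
  have h : e.1.1 ≤ e.1.2 := by simpa [edges] using e.2
  apply Subtype.ext
  simp [edgeOf, h]

theorem edgeOf_left_injective (a : Fin n) : Function.Injective (edgeOf a) := by
  intro b c h
  have h1 := congrArg (fun e => e.1.1) h
  have h2 := congrArg (fun e => e.1.2) h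
  simp only [edgeOf] at h1 h2
  grind

theorem apply_edgeOf {M : Matrix (Fin n) (Fin n) ℝ} (hM : M.IsSymm) (a b : Fin n) :
    M (edgeOf a b).1.1 (edgeOf a b).1.2 = M a b := by
  rcases le_total a b with h | h
  · simp [edgeOf, h]
  · simp only [edgeOf, min_eq_right h, max_eq_left h]
    exact hM.apply a b

end Edges

/-! ### Independence of the edges and moments of the process -/

section Law

variable {n K : ℕ} {Ω : Type*} [MeasurableSpace Ω] {μ : Measure Ω}
  {P : Matrix (Fin n) (Fin n) ℝ} {α : ℝ} {A : Fin (K + 1) → Ω → Matrix (Fin n) (Fin n) ℝ}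

theorem IsAdjacency.edgeValue_decide {M : Matrix (Fin n) (Fin n) ℝ} (hM : IsAdjacency M)
    (i j : Fin n) : edgeValue (decide (M i j = 1)) = M i j := by
  rcases hM.2 i j with h | h <;> simp [edgeValue, h]

theorem IsLazyIER.measurableSet_eq (hA : IsLazyIER μ P α A) (t : Fin (K + 1))
    (M : Matrix (Fin n) (Fin n) ℝ) : MeasurableSet {ω | A t ω = M} := by
  have : {ω | A t ω = M} = ⋂ i, ⋂ j, {ω | A t ω i j = M i j} := by
    ext ω
    simp [← Matrix.ext_iff]
  rw [this]
  exact MeasurableSet.iInter fun i => MeasurableSet.iInter fun j =>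
    hA.measurable t i j (measurableSet_singleton _)

/-- Along the layers, the conditional laws multiply up to a product over the edges. -/
theorem IsLazyIER.measureReal_prefix [IsProbabilityMeasure μ] (hA : IsLazyIER μ P α A)
    {M : Fin (K + 1) → Matrix (Fin n) (Fin n) ℝ} (hM : ∀ r, IsAdjacency (M r))
    (k : ℕ) (hk : k < K + 1) :
    μ.real {ω | ∀ r ≤ (⟨k, hk⟩ : Fin (K + 1)), A r ω = M r} =
      ∏ e ∈ edges n, pathMass α (P e.1 e.2) k
        (fun i => decide (M ⟨i, by omega⟩ e.1 e.2 = 1)) := by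
  induction k with
  | zero =>
    have h0 : {ω | ∀ r ≤ (⟨0, hk⟩ : Fin (K + 1)), A r ω = M r} =
        {ω | A ⟨0, hk⟩ ω = M ⟨0, hk⟩} := by
      ext ω
      refine ⟨fun h => h _ le_rfl, fun h r hr => ?_⟩
      have : r = ⟨0, hk⟩ := Fin.ext (Nat.le_zero.1 hr)
      rw [this]; exact h
    rw [h0, hA.initial _ rfl _ (hM _)]
    refine Finset.prod_congr rfl fun e _ => ?_
    simp only [pathMass]
    rw [(hM _).edgeValue_decide]
    rfl
  | succ k ih =>
    have hk' : k < K + 1 := by omega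
    set B := {ω | ∀ r ≤ (⟨k, hk'⟩ : Fin (K + 1)), A r ω = M r} with hB
    set C := {ω | A ⟨k + 1, hk⟩ ω = M ⟨k + 1, hk⟩} with hC
    have hBC : {ω | ∀ r ≤ (⟨k + 1, hk⟩ : Fin (K + 1)), A r ω = M r} = B ∩ C := by
      ext ω
      refine ⟨fun h => ⟨fun r hr => h r (hr.trans (Fin.mk_le_mk.2 (Nat.le_succ k))),
        h _ le_rfl⟩, fun h r hr => ?_⟩
      rcases Nat.lt_or_ge k r with hkr | hkr
      · have : r = ⟨k + 1, hk⟩ := Fin.ext (le_antisymm hr hkr)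
        rw [this]; exact h.2
      · exact h.1 r hkr
    have hBm : MeasurableSet B := by
      have : B = ⋂ r, ⋂ (_ : r ≤ (⟨k, hk'⟩ : Fin (K + 1))), {ω | A r ω = M r} := by
        ext ω; simp [hB]
      rw [this]
      exact MeasurableSet.iInter fun r => MeasurableSet.iInter fun _ => hA.measurableSet_eq r _
    have hprod : (∏ e ∈ edges n, pathMass α (P e.1 e.2) (k + 1)
        (fun i => decide (M ⟨i, by omega⟩ e.1 e.2 = 1))) = μ.real B *
        ∏ e ∈ edges n, lazyStep α (P e.1 e.2) (M ⟨k, hk'⟩ e.1 e.2)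
          (M ⟨k + 1, hk⟩ e.1 e.2) := by
      rw [ih hk', ← Finset.prod_mul_distrib]
      refine Finset.prod_congr rfl fun e _ => ?_
      simp only [pathMass]
      rw [(hM _).edgeValue_decide, (hM _).edgeValue_decide]
      rfl
    rw [hBC, hprod]
    by_cases h0 : μ B = 0
    · have h1 : μ.real B = 0 := by simp [Measure.real, h0]
      have h2 : μ.real (B ∩ C) = 0 := by
        simp [Measure.real, measure_mono_null Set.inter_subset_left h0]
      rw [h1, h2, zero_mul]
    · rw [← hA.step ⟨k, hk'⟩ ⟨k + 1, hk⟩ rfl M hM h0]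
      have h1 : μ.real B ≠ 0 := by
        simp [Measure.real, h0, ENNReal.toReal_eq_zero_iff]
      change _ = _ * (μ[|B]).real C
      rw [measureReal_def (μ[|B]), cond_apply hBm, ENNReal.toReal_mul, ENNReal.toReal_inv,
        ← measureReal_def, ← measureReal_def, mul_inv_cancel_left₀ h1]

/-- The sequence of states of an edge. -/
noncomputable def edgePath (A : Fin (K + 1) → Ω → Matrix (Fin n) (Fin n) ℝ)
    (e : {e // e ∈ edges n}) (ω : Ω) : Fin (K + 1) → Bool :=
  fun t => decide (A t ω e.1.1 e.1.2 = 1)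

theorem IsLazyIER.measurable_edgePath (hA : IsLazyIER μ P α A) (e : {e // e ∈ edges n}) :
    Measurable (edgePath A e) := by
  refine measurable_pi_lambda _ fun t => measurable_to_bool ?_
  have : (fun ω => edgePath A e ω t) ⁻¹' {true} = {ω | A t ω e.1.1 e.1.2 = 1} := by
    ext ω; simp [edgePath]
  rw [this]
  exact hA.measurable t _ _ (measurableSet_singleton _)

/-- The law of the sequence of states of an edge with parameter `p`. -/
noncomputable def pathLaw (α p : ℝ) (K : ℕ) : Measure (Fin (K + 1) → Bool) :=
  ∑ y, ENNReal.ofReal (pathMass α p K y) • Measure.dirac y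

theorem pathLaw_singleton (α p : ℝ) (K : ℕ) (y : Fin (K + 1) → Bool) :
    pathLaw α p K {y} = ENNReal.ofReal (pathMass α p K y) := by
  simp [pathLaw, Set.indicator_apply]

theorem isProbabilityMeasure_pathLaw (hα : α ∈ Set.Ioo (0 : ℝ) 1) {p : ℝ}
    (hp : p ∈ Set.Icc (0 : ℝ) 1) (K : ℕ) : IsProbabilityMeasure (pathLaw α p K) := by
  constructor
  simp only [pathLaw, Measure.coe_finsetSum, Finset.sum_apply, Measure.smul_apply,
    measure_univ, smul_eq_mul, mul_one]
  rw [← ENNReal.ofReal_sum_of_nonneg fun y _ => pathMass_nonneg hα hp K y, sum_pathMass,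
    ENNReal.ofReal_one]

/-- The joint law of the edge paths is a product measure. -/
theorem IsLazyIER.map_edgePath_pi [IsProbabilityMeasure μ] (hA : IsLazyIER μ P α A)
    (hα : α ∈ Set.Ioo (0 : ℝ) 1) (hP : ∀ i j, P i j ∈ Set.Icc (0 : ℝ) 1) :
    μ.map (fun ω e => edgePath A e ω) =
      Measure.pi fun e : {e // e ∈ edges n} => pathLaw α (P e.1.1 e.1.2) K := by
  have := fun e : {e // e ∈ edges n} =>
    isProbabilityMeasure_pathLaw hα (hP e.1.1 e.1.2) K
  refine Measure.ext_of_singleton fun x => ?_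
  rw [Measure.pi_singleton, Measure.map_apply
    (measurable_pi_lambda _ fun e => hA.measurable_edgePath e) (measurableSet_singleton x)]
  simp only [pathLaw_singleton]
  rw [← ENNReal.ofReal_prod_of_nonneg fun e _ => pathMass_nonneg hα (hP _ _) K _]
  set M : Fin (K + 1) → Matrix (Fin n) (Fin n) ℝ := fun t =>
    Matrix.of fun a b => edgeValue (x (edgeOf a b) t) with hMdef
  have hM : ∀ r, IsAdjacency (M r) := fun r => by
    refine ⟨Matrix.IsSymm.ext fun i j => ?_, fun i j => ?_⟩
    · simp [hMdef, edgeOf_comm]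
    · simp only [hMdef, Matrix.of_apply, edgeValue]
      split_ifs <;> simp
  have hdec : ∀ b : Bool, decide (edgeValue b = 1) = b := fun b => by
    cases b <;> simp [edgeValue]
  have h1 := hA.measureReal_prefix hM K (Nat.lt_succ_self K)
  have hset : (fun ω e => edgePath A e ω) ⁻¹' {x} =
      {ω | ∀ r ≤ (⟨K, Nat.lt_succ_self K⟩ : Fin (K + 1)), A r ω = M r} := by
    ext ω
    simp only [Set.mem_preimage, Set.mem_singleton_iff, Set.mem_ofPred_eq]
    constructor
    · rintro h r -
      ext a b
      have h2 := congrFun (congrFun h (edgeOf a b)) r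
      simp only [hMdef, Matrix.of_apply, ← h2, edgePath]
      rw [(hA.isAdjacency r ω).edgeValue_decide, apply_edgeOf (hA.isAdjacency r ω).1]
    · intro h
      funext e t
      rw [edgePath, h t (Nat.lt_succ_iff.1 t.2)]
      simp only [hMdef, Matrix.of_apply, edgeOf_fst_snd, hdec]
  rw [hset, ← ofReal_measureReal, h1, ← Finset.prod_coe_sort]
  congr 1
  refine Finset.prod_congr rfl fun e _ => ?_
  congr 1
  funext i
  simp only [hMdef, Matrix.of_apply, edgeOf_fst_snd, hdec]

theorem IsLazyIER.map_edgePath [IsProbabilityMeasure μ] (hA : IsLazyIER μ P α A)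
    (hα : α ∈ Set.Ioo (0 : ℝ) 1) (hP : ∀ i j, P i j ∈ Set.Icc (0 : ℝ) 1)
    (e : {e // e ∈ edges n}) : μ.map (edgePath A e) = pathLaw α (P e.1.1 e.1.2) K := by
  have := fun e : {e // e ∈ edges n} =>
    isProbabilityMeasure_pathLaw hα (hP e.1.1 e.1.2) K
  have h1 := (measurePreserving_eval
    (fun e : {e // e ∈ edges n} => pathLaw α (P e.1.1 e.1.2) K) e).map_eq
  rw [← hA.map_edgePath_pi hα hP, Measure.map_map (measurable_pi_apply e)
    (measurable_pi_lambda _ fun e => hA.measurable_edgePath e)] at h1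
  exact h1

theorem IsLazyIER.iIndepFun_edgePath [IsProbabilityMeasure μ] (hA : IsLazyIER μ P α A)
    (hα : α ∈ Set.Ioo (0 : ℝ) 1) (hP : ∀ i j, P i j ∈ Set.Icc (0 : ℝ) 1) :
    iIndepFun (edgePath A) μ := by
  rw [iIndepFun_iff_map_fun_eq_pi_map fun e => (hA.measurable_edgePath e).aemeasurable,
    hA.map_edgePath_pi hα hP]
  simp only [hA.map_edgePath hα hP]

/-- The deviation of the number of layers containing the edge `e` from its mean. -/
noncomputable def edgeDev (P : Matrix (Fin n) (Fin n) ℝ)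
    (A : Fin (K + 1) → Ω → Matrix (Fin n) (Fin n) ℝ) (e : {e // e ∈ edges n}) (ω : Ω) : ℝ :=
  ∑ t, (A t ω e.1.1 e.1.2 - P e.1.1 e.1.2)

theorem IsLazyIER.edgeDev_eq (hA : IsLazyIER μ P α A) (e : {e // e ∈ edges n}) (ω : Ω) :
    edgeDev P A e ω = ∑ t, (edgeValue (edgePath A e ω t) - P e.1.1 e.1.2) := by
  simp only [edgePath, (hA.isAdjacency _ _).edgeValue_decide, edgeDev]

theorem IsLazyIER.measurable_edgeDev (hA : IsLazyIER μ P α A) (e : {e // e ∈ edges n}) :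
    Measurable (edgeDev P A e) :=
  Finset.measurable_sum _ fun t _ => (hA.measurable t _ _).sub_const _

theorem IsLazyIER.iIndepFun_edgeDev [IsProbabilityMeasure μ] (hA : IsLazyIER μ P α A)
    (hα : α ∈ Set.Ioo (0 : ℝ) 1) (hP : ∀ i j, P i j ∈ Set.Icc (0 : ℝ) 1) :
    iIndepFun (edgeDev P A) μ := by
  have h := (hA.iIndepFun_edgePath hα hP).comp
    (fun e y => ∑ t, (edgeValue (y t) - P e.1.1 e.1.2)) (fun e => measurable_of_countable _)
  convert h using 2 with e
  funext ω
  exact hA.edgeDev_eq e ω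

theorem IsLazyIER.lintegral_exp_edgeDev_le [IsProbabilityMeasure μ] (hA : IsLazyIER μ P α A)
    (hα : α ∈ Set.Ioo (0 : ℝ) 1) (hP : ∀ i j, P i j ∈ Set.Icc (0 : ℝ) 1)
    (e : {e // e ∈ edges n}) (l : ℝ) (hl : |l| ≤ (1 - α) / 4) :
    ∫⁻ ω, ENNReal.ofReal (Real.exp (l * edgeDev P A e ω)) ∂μ ≤
      ENNReal.ofReal (Real.exp (lazyConst α * (K + 1) * P e.1.1 e.1.2 * l ^ 2)) := by
  simp only [hA.edgeDev_eq]
  rw [← lintegral_map (f := fun y : Fin (K + 1) → Bool => ENNReal.ofReal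
    (Real.exp (l * ∑ t, (edgeValue (y t) - P e.1.1 e.1.2)))) (measurable_of_countable _)
    (hA.measurable_edgePath e), hA.map_edgePath hα hP, lintegral_fintype]
  refine le_trans (le_of_eq ?_)
    (ENNReal.ofReal_le_ofReal (sum_pathMass_mul_exp_le hα (hP e.1.1 e.1.2) hl K))
  rw [ENNReal.ofReal_sum_of_nonneg fun y _ =>
    mul_nonneg (pathMass_nonneg hα (hP _ _) K y) (Real.exp_pos _).le]
  refine Finset.sum_congr rfl fun y _ => ?_
  rw [pathLaw_singleton, ENNReal.ofReal_mul (pathMass_nonneg hα (hP _ _) K y), mul_comm]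

theorem IsLazyIER.integrable_apply [IsProbabilityMeasure μ] (hA : IsLazyIER μ P α A)
    (t : Fin (K + 1)) (i j : Fin n) : Integrable (fun ω => A t ω i j) μ := by
  refine Integrable.of_bound (hA.measurable t i j).aestronglyMeasurable 1
    (Eventually.of_forall fun ω => ?_)
  rcases (hA.isAdjacency t ω).2 i j with h | h <;> simp [h]

/-- A real random variable with a Gaussian bound on its moment generating function near `0` is
centered. -/
theorem integral_eq_zero_of_lintegral_exp_le [IsProbabilityMeasure μ] {X : Ω → ℝ}
    (hX : Integrable X μ) {v r : ℝ} (hr : 0 < r)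
    (h : ∀ l, |l| ≤ r →
      ∫⁻ ω, ENNReal.ofReal (Real.exp (l * X ω)) ∂μ ≤ ENNReal.ofReal (Real.exp (v * l ^ 2))) :
    ∫ ω, X ω ∂μ = 0 := by
  set m := ∫ ω, X ω ∂μ with hm
  have hle : ∀ l, |l| ≤ r → 1 + l * m - Real.exp (v * l ^ 2) ≤ 0 := by
    intro l hl
    have hXm : AEStronglyMeasurable (fun ω => Real.exp (l * X ω)) μ :=
      Real.continuous_exp.comp_aestronglyMeasurable (hX.aestronglyMeasurable.const_mul l)
    have hpos : 0 ≤ᵐ[μ] fun ω => Real.exp (l * X ω) :=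
      Eventually.of_forall fun ω => (Real.exp_pos _).le
    have hint : Integrable (fun ω => Real.exp (l * X ω)) μ :=
      (lintegral_ofReal_ne_top_iff_integrable hXm hpos).1
        ((h l hl).trans_lt ENNReal.ofReal_lt_top).ne
    have h1 := h l hl
    rw [← ofReal_integral_eq_lintegral_ofReal hint hpos,
      ENNReal.ofReal_le_ofReal_iff (Real.exp_pos _).le] at h1
    have h2 : 1 + l * m = ∫ ω, (1 + l * X ω) ∂μ := by
      rw [integral_add (integrable_const _) (hX.const_mul l), integral_const_mul]
      simp [hm]
    have h3 : ∫ ω, (1 + l * X ω) ∂μ ≤ ∫ ω, Real.exp (l * X ω) ∂μ :=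
      integral_mono ((integrable_const _).add (hX.const_mul l)) hint fun ω => by
        linarith [Real.add_one_le_exp (l * X ω)]
    linarith
  have hmax : IsLocalMax (fun l : ℝ => 1 + l * m - Real.exp (v * l ^ 2)) 0 := by
    filter_upwards [Metric.closedBall_mem_nhds (0 : ℝ) hr] with l hl
    have := hle l (by simpa using hl)
    simpa using this
  have hd : HasDerivAt (fun l : ℝ => 1 + l * m - Real.exp (v * l ^ 2)) m 0 := by
    have h1 := ((hasDerivAt_id (0 : ℝ)).mul_const m).const_add 1
    have h2 := (((hasDerivAt_id (0 : ℝ)).pow 2).const_mul v).exp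
    exact HasDerivAt.congr_deriv (h1.sub h2) (by simp)
  exact hmax.hasDerivAt_eq_zero hd

theorem IsLazyIER.integral_edgeDev [IsProbabilityMeasure μ] (hA : IsLazyIER μ P α A)
    (hα : α ∈ Set.Ioo (0 : ℝ) 1) (hP : ∀ i j, P i j ∈ Set.Icc (0 : ℝ) 1)
    (e : {e // e ∈ edges n}) : ∫ ω, edgeDev P A e ω ∂μ = 0 := by
  refine integral_eq_zero_of_lintegral_exp_le ?_ (r := (1 - α) / 4)
    (v := lazyConst α * (K + 1) * P e.1.1 e.1.2) (by linarith [hα.2])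
    (hA.lintegral_exp_edgeDev_le hα hP e)
  exact integrable_finsetSum _ fun t _ => (hA.integrable_apply t _ _).sub (integrable_const _)

theorem aggAdj_apply {n T : ℕ} {Ω : Type*} (A : Fin T → Ω → Matrix (Fin n) (Fin n) ℝ)
    (ω : Ω) (i j : Fin n) : aggAdj A ω i j = ∑ t, A t ω i j := by
  simp [aggAdj, Matrix.sum_apply]

theorem IsLazyIER.edgeDev_edgeOf (hA : IsLazyIER μ P α A) (hPs : P.IsSymm) (ω : Ω)
    (i j : Fin n) : edgeDev P A (edgeOf i j) ω = aggAdj A ω i j - (K + 1) * P i j := by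
  simp only [edgeDev, apply_edgeOf hPs, fun t => apply_edgeOf (hA.isAdjacency t ω).1,
    aggAdj_apply]
  simp

theorem IsLazyIER.meanAdj_apply [IsProbabilityMeasure μ] (hA : IsLazyIER μ P α A)
    (hα : α ∈ Set.Ioo (0 : ℝ) 1) (hP : ∀ i j, P i j ∈ Set.Icc (0 : ℝ) 1) (hPs : P.IsSymm)
    (i j : Fin n) : meanAdj μ A i j = (K + 1) * P i j := by
  have h1 := hA.integral_edgeDev hα hP (edgeOf i j)
  simp only [hA.edgeDev_edgeOf hPs] at h1
  have hint : Integrable (fun ω => aggAdj A ω i j) μ := by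
    simp only [aggAdj_apply]
    exact integrable_finsetSum _ fun t _ => hA.integrable_apply t i j
  rw [integral_sub hint (integrable_const _), sub_eq_zero] at h1
  simpa [meanAdj] using h1

theorem aggDegree_eq {n T : ℕ} {Ω : Type*} (A : Fin T → Ω → Matrix (Fin n) (Fin n) ℝ)
    (ω : Ω) (i : Fin n) : aggDegree A ω i = ∑ j, aggAdj A ω i j := by
  simp only [aggDegree, aggAdj_apply]
  exact Finset.sum_comm

theorem IsLazyIER.meanDegree_eq [IsProbabilityMeasure μ] (hA : IsLazyIER μ P α A) (i : Fin n) :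
    meanDegree μ A i = ∑ j, meanAdj μ A i j := by
  simp only [meanDegree, aggDegree_eq, meanAdj, Matrix.of_apply]
  refine integral_finsetSum _ fun j _ => ?_
  simp only [aggAdj_apply]
  exact integrable_finsetSum _ fun t _ => hA.integrable_apply t i j

end Law

/-! ### Matrices attached to edges -/

section EdgeMatrices

variable {n : ℕ}

/-- The matrix of the edge `e` with weights `w`. -/
def edgeMatrix (w : Matrix (Fin n) (Fin n) ℝ) (e : {e // e ∈ edges n}) :
    Matrix (Fin n) (Fin n) ℝ :=
  Matrix.of fun a b => if edgeOf a b = e then w a b else 0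

/-- The diagonal matrix with weights `u` on the endpoints of the edge `e`. -/
def endpointMatrix (u : Fin n → ℝ) (e : {e // e ∈ edges n}) : Matrix (Fin n) (Fin n) ℝ :=
  diagonal fun a => ∑ b, if edgeOf a b = e then u a else 0

/-- At most one term of the sum is nonzero. -/
theorem sq_sum_ite_edgeOf (a : Fin n) (e : {e // e ∈ edges n}) (f : Fin n → ℝ) :
    (∑ b, if edgeOf a b = e then f b else 0) ^ 2 = ∑ b, if edgeOf a b = e then f b ^ 2 else 0 := by
  by_cases h : ∃ b, edgeOf a b = e
  · obtain ⟨b, rfl⟩ := h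
    simp [(edgeOf_left_injective a).eq_iff]
  · push Not at h
    simp [h]

theorem sum_ite_edgeOf_le (b : Fin n) (e : {e // e ∈ edges n}) {c : ℝ} (hc : 0 ≤ c) :
    (∑ a, if edgeOf a b = e then c else 0) ≤ c := by
  by_cases h : ∃ a, edgeOf b a = e
  · obtain ⟨a, rfl⟩ := h
    simp [edgeOf_comm _ b, (edgeOf_left_injective b).eq_iff]
  · push Not at h
    simpa [edgeOf_comm _ b, h] using hc

theorem edgeMatrix_quadForm (w : Matrix (Fin n) (Fin n) ℝ) (e : {e // e ∈ edges n})
    (ξ : Fin n → ℝ) : (edgeMatrix w e *ᵥ ξ) ⬝ᵥ (edgeMatrix w e *ᵥ ξ) =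
      ∑ a, ∑ b, if edgeOf a b = e then w a b ^ 2 * ξ b ^ 2 else 0 := by
  refine Finset.sum_congr rfl fun a _ => ?_
  rw [← sq]
  simp only [mulVec, dotProduct, edgeMatrix, Matrix.of_apply, ite_mul, zero_mul]
  rw [sq_sum_ite_edgeOf]
  simp only [mul_pow]

theorem endpointMatrix_quadForm (u : Fin n → ℝ) (e : {e // e ∈ edges n})
    (ξ : Fin n → ℝ) : (endpointMatrix u e *ᵥ ξ) ⬝ᵥ (endpointMatrix u e *ᵥ ξ) =
      ∑ a, ∑ b, if edgeOf a b = e then u a ^ 2 * ξ a ^ 2 else 0 := by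
  refine Finset.sum_congr rfl fun a _ => ?_
  rw [← sq, endpointMatrix, mulVec_diagonal, mul_pow, sq_sum_ite_edgeOf, Finset.sum_mul]
  simp only [ite_mul, zero_mul]

theorem sum_mul_sum_ite_edgeOf (v : {e // e ∈ edges n} → ℝ) (q : Fin n → Fin n → ℝ) :
    ∑ e, v e * ∑ a, ∑ b, (if edgeOf a b = e then q a b else 0) =
      ∑ a, ∑ b, v (edgeOf a b) * q a b := by
  simp only [Finset.mul_sum]
  rw [Finset.sum_comm]
  refine Finset.sum_congr rfl fun a _ => ?_
  rw [Finset.sum_comm]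
  refine Finset.sum_congr rfl fun b _ => ?_
  simp

theorem sum_smul_edgeMatrix (x : {e // e ∈ edges n} → ℝ) (w : Matrix (Fin n) (Fin n) ℝ) :
    ∑ e, x e • edgeMatrix w e = Matrix.of fun a b => w a b * x (edgeOf a b) := by
  ext a b
  simp [Matrix.sum_apply, edgeMatrix, mul_comm]

theorem sum_smul_endpointMatrix (x : {e // e ∈ edges n} → ℝ) (u : Fin n → ℝ) :
    ∑ e, x e • endpointMatrix u e = diagonal fun a => u a * ∑ b, x (edgeOf a b) := by
  ext a b
  rcases eq_or_ne a b with rfl | hab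
  · simp only [Matrix.sum_apply, endpointMatrix, Matrix.smul_apply, diagonal_apply_eq, smul_eq_mul,
      Finset.mul_sum]
    rw [Finset.sum_comm]
    refine Finset.sum_congr rfl fun b _ => ?_
    simp [mul_comm]
  · simp [Matrix.sum_apply, endpointMatrix, hab]

end EdgeMatrices

/-! ### Concentration of weighted edge sums -/

section Concentration

variable {n K : ℕ} {Ω : Type*} [MeasurableSpace Ω] {μ : Measure Ω}
  {P : Matrix (Fin n) (Fin n) ℝ} {α : ℝ} {A : Fin (K + 1) → Ω → Matrix (Fin n) (Fin n) ℝ}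

/-- The constant in the concentration inequalities for weighted sums over the edges. -/
noncomputable def concConst (α : ℝ) : ℝ := lazyConst α * ((1 - α) / 4) + 4 / (1 - α)

theorem lazyConst_pos (hα : α ∈ Set.Ioo (0 : ℝ) 1) : 0 < lazyConst α := by
  have := sub_pos.2 hα.2
  unfold lazyConst
  positivity

theorem four_lt_concConst (hα : α ∈ Set.Ioo (0 : ℝ) 1) : 4 < concConst α := by
  have h1 := sub_pos.2 hα.2
  have h2 := lazyConst_pos hα
  have h3 : 4 < 4 / (1 - α) := by
    rw [lt_div_iff₀ h1]; linarith [hα.1]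
  unfold concConst
  have : 0 < lazyConst α * ((1 - α) / 4) := by positivity
  linarith

/-- The matrix Bernstein bound for coefficients `edgeDev`, with weights scaled such that the
matrices have norm at most `m⁻¹` and the variance proxy is of order `m⁻¹`. -/
theorem IsLazyIER.measureReal_opNorm_sum_gt_le [IsProbabilityMeasure μ] (hA : IsLazyIER μ P α A)
    (hα : α ∈ Set.Ioo (0 : ℝ) 1) (hP : ∀ i j, P i j ∈ Set.Icc (0 : ℝ) 1)
    {H : {e // e ∈ edges n} → Matrix (Fin n) (Fin n) ℝ} (hH : ∀ e, (H e).IsSymm) {m L : ℝ}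
    (hm : 0 < m) (hL : 0 ≤ L) (hLm : L ≤ m)
    (hHR : ∀ e ξ, (H e *ᵥ ξ) ⬝ᵥ (H e *ᵥ ξ) ≤ m⁻¹ ^ 2 * (ξ ⬝ᵥ ξ))
    (hσ : ∀ ξ, ∑ e, (K + 1) * P e.1.1 e.1.2 * ((H e *ᵥ ξ) ⬝ᵥ (H e *ᵥ ξ)) ≤ m⁻¹ * (ξ ⬝ᵥ ξ)) :
    μ.real {ω | concConst α * √(L / m) < opNorm (∑ e, edgeDev P A e ω • H e)} ≤
      2 * n * Real.exp (-L) := by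
  have hα1 := sub_pos.2 hα.2
  set r := (1 - α) / 4 with hr
  have hr0 : 0 < r := by positivity
  have hB : 0 < concConst α := by linarith [four_lt_concConst hα]
  have hκ := lazyConst_pos hα
  have hsq : √(L * m) * √(L / m) = L := by
    rw [← Real.sqrt_mul (by positivity)]
    have : L * m * (L / m) = L ^ 2 := by field_simp
    rw [this, Real.sqrt_sq hL]
  have h := measureReal_opNorm_gt_le (hA.iIndepFun_edgeDev hα hP) hA.measurable_edgeDev hr0.le
    (v := fun e => lazyConst α * (K + 1) * P e.1.1 e.1.2)
    (hA.lintegral_exp_edgeDev_le hα hP) hH (R := m⁻¹) (σ := lazyConst α * m⁻¹)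
    (θ := r * √(L * m)) (by positivity) hHR (by positivity) ?_ ?_
    (s := concConst α * √(L / m)) (by positivity)
  · refine h.trans_eq ?_
    congr 2
    have h1 : √(L * m) ^ 2 = L * m := Real.sq_sqrt (by positivity)
    have h2 : lazyConst α * m⁻¹ * (r * √(L * m)) ^ 2 = lazyConst α * r ^ 2 * L := by
      rw [mul_pow, h1]; field_simp
    have h3 : r * √(L * m) * (concConst α * √(L / m)) = r * concConst α * L := by
      linear_combination r * concConst α * hsq
    rw [h2, h3, concConst, ← hr]
    have h4 : r * (4 / (1 - α)) = 1 := by rw [hr]; field_simp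
    linear_combination -L * h4
  · rw [mul_assoc]
    refine mul_le_of_le_one_right hr0.le ?_
    rw [← div_eq_mul_inv, div_le_one hm]
    calc √(L * m) ≤ √(m * m) := Real.sqrt_le_sqrt (by gcongr)
      _ = m := Real.sqrt_mul_self hm.le
  · intro ξ
    calc _ = lazyConst α * ∑ e : {e // e ∈ edges n},
          (K + 1) * P e.1.1 e.1.2 * ((H e *ᵥ ξ) ⬝ᵥ (H e *ᵥ ξ)) := by
          rw [Finset.mul_sum]
          exact Finset.sum_congr rfl fun e _ => by ring
      _ ≤ lazyConst α * (m⁻¹ * (ξ ⬝ᵥ ξ)) := by gcongr; exact hσ ξ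
      _ = _ := by ring

theorem IsLazyIER.measureReal_opNorm_weighted_gt_le [IsProbabilityMeasure μ]
    (hA : IsLazyIER μ P α A) (hα : α ∈ Set.Ioo (0 : ℝ) 1)
    (hP : ∀ i j, P i j ∈ Set.Icc (0 : ℝ) 1) (hPs : P.IsSymm) {w : Matrix (Fin n) (Fin n) ℝ}
    (hw : w.IsSymm) {m L : ℝ} (hm : 0 < m) (hL : 0 ≤ L) (hLm : L ≤ m)
    (hwm : ∀ a b, |w a b| ≤ m⁻¹) (hσ : ∀ b, ∑ a, (K + 1) * P a b * w a b ^ 2 ≤ m⁻¹) :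
    μ.real {ω | concConst α * √(L / m) <
      opNorm (Matrix.of fun a b => w a b * (aggAdj A ω a b - meanAdj μ A a b))} ≤
      2 * n * Real.exp (-L) := by
  have hm' : 0 < m⁻¹ := inv_pos.2 hm
  have h := hA.measureReal_opNorm_sum_gt_le hα hP (H := edgeMatrix w) (fun e => ?_) hm hL hLm
    (fun e ξ => ?_) (fun ξ => ?_)
  · simpa only [sum_smul_edgeMatrix, hA.edgeDev_edgeOf hPs, hA.meanAdj_apply hα hP hPs] using h
  · refine Matrix.IsSymm.ext fun i j => ?_
    simp only [edgeMatrix, Matrix.of_apply, edgeOf_comm j i, hw.apply]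
  · rw [edgeMatrix_quadForm, Finset.sum_comm, dotProduct, Finset.mul_sum]
    refine Finset.sum_le_sum fun b _ => ?_
    refine le_trans (Finset.sum_le_sum fun a _ => ?_)
      (sum_ite_edgeOf_le b e (c := m⁻¹ ^ 2 * (ξ b * ξ b))
        (mul_nonneg (sq_nonneg _) (mul_self_nonneg _)))
    split_ifs
    · rw [← sq (ξ b)]
      exact mul_le_mul_of_nonneg_right (sq_le_sq.2 ((hwm a b).trans_eq (abs_of_pos hm').symm))
        (sq_nonneg _)
    · rfl
  · simp only [edgeMatrix_quadForm]
    rw [sum_mul_sum_ite_edgeOf (fun e => (K + 1) * P e.1.1 e.1.2), Finset.sum_comm, dotProduct,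
      Finset.mul_sum]
    refine Finset.sum_le_sum fun b _ => ?_
    simp only [apply_edgeOf hPs]
    calc ∑ a, (K + 1) * P a b * (w a b ^ 2 * ξ b ^ 2)
        = (∑ a, (K + 1) * P a b * w a b ^ 2) * ξ b ^ 2 := by
          rw [Finset.sum_mul]; exact Finset.sum_congr rfl fun a _ => by ring
      _ ≤ m⁻¹ * ξ b ^ 2 := by gcongr; exact hσ b
      _ = _ := by rw [sq]

theorem IsLazyIER.measureReal_opNorm_degree_gt_le [IsProbabilityMeasure μ]
    (hA : IsLazyIER μ P α A) (hα : α ∈ Set.Ioo (0 : ℝ) 1)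
    (hP : ∀ i j, P i j ∈ Set.Icc (0 : ℝ) 1) (hPs : P.IsSymm) {u : Fin n → ℝ}
    {m L : ℝ} (hm : 0 < m) (hL : 0 ≤ L) (hLm : L ≤ m)
    (hum : ∀ a, |u a| ≤ m⁻¹) (hσ : ∀ a, (∑ b, (K + 1) * P a b) * u a ^ 2 ≤ m⁻¹) :
    μ.real {ω | concConst α * √(L / m) <
      opNorm (diagonal fun a => u a * (aggDegree A ω a - meanDegree μ A a))} ≤
      2 * n * Real.exp (-L) := by
  have hm' : 0 < m⁻¹ := inv_pos.2 hm
  have h := hA.measureReal_opNorm_sum_gt_le hα hP (H := endpointMatrix u) (fun e => ?_) hm hL hLm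
    (fun e ξ => ?_) (fun ξ => ?_)
  · simpa only [sum_smul_endpointMatrix, hA.edgeDev_edgeOf hPs, Finset.sum_sub_distrib,
      aggDegree_eq, hA.meanDegree_eq, hA.meanAdj_apply hα hP hPs] using h
  · exact isSymm_diagonal _
  · rw [endpointMatrix_quadForm, dotProduct, Finset.mul_sum]
    refine Finset.sum_le_sum fun a _ => ?_
    have h1 := sum_ite_edgeOf_le a e (c := m⁻¹ ^ 2 * (ξ a * ξ a))
        (mul_nonneg (sq_nonneg _) (mul_self_nonneg _))
    simp only [edgeOf_comm _ a] at h1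
    refine le_trans (Finset.sum_le_sum fun b _ => ?_) h1
    split_ifs
    · rw [← sq (ξ a)]
      exact mul_le_mul_of_nonneg_right (sq_le_sq.2 ((hum a).trans_eq (abs_of_pos hm').symm))
        (sq_nonneg _)
    · rfl
  · simp only [endpointMatrix_quadForm]
    rw [sum_mul_sum_ite_edgeOf (fun e => (K + 1) * P e.1.1 e.1.2), dotProduct,
      Finset.mul_sum]
    refine Finset.sum_le_sum fun a _ => ?_
    simp only [apply_edgeOf hPs]
    calc ∑ b, (K + 1) * P a b * (u a ^ 2 * ξ a ^ 2)
        = (∑ b, (K + 1) * P a b) * u a ^ 2 * ξ a ^ 2 := by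
          rw [← Finset.sum_mul]; ring
      _ ≤ m⁻¹ * ξ a ^ 2 := by gcongr; exact hσ a
      _ = _ := by rw [sq]

end Concentration

/-! ### Perturbation of the normalized Laplacian -/

section Laplacian

variable {n : ℕ}

theorem opNorm_add_le (M N : Matrix (Fin n) (Fin n) ℝ) : opNorm (M + N) ≤ opNorm M + opNorm N := by
  unfold opNorm
  rw [map_add]
  exact norm_add_le _ _

theorem opNorm_mul_le (M N : Matrix (Fin n) (Fin n) ℝ) : opNorm (M * N) ≤ opNorm M * opNorm N := by
  unfold opNorm
  rw [map_mul]
  exact norm_mul_le _ _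

theorem opNorm_neg (M : Matrix (Fin n) (Fin n) ℝ) : opNorm (-M) = opNorm M := by
  unfold opNorm
  rw [map_neg, norm_neg]

theorem opNorm_smul (c : ℝ) (M : Matrix (Fin n) (Fin n) ℝ) : opNorm (c • M) = |c| * opNorm M := by
  unfold opNorm
  rw [map_smul, norm_smul, Real.norm_eq_abs]

theorem opNorm_nonneg (M : Matrix (Fin n) (Fin n) ℝ) : 0 ≤ opNorm M := norm_nonneg _

theorem opNorm_diagonal_le {u : Fin n → ℝ} {s : ℝ} (hs : 0 ≤ s) (h : ∀ i, |u i| ≤ s) :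
    opNorm (diagonal u) ≤ s := by
  refine opNorm_le_of_forall hs fun v => ?_
  simp only [dotProduct, mulVec_diagonal, Finset.mul_sum]
  refine Finset.sum_le_sum fun i _ => ?_
  have h1 : u i ^ 2 ≤ s ^ 2 := sq_le_sq.2 ((h i).trans_eq (abs_of_nonneg hs).symm)
  nlinarith [mul_le_mul_of_nonneg_right h1 (mul_self_nonneg (v i))]

theorem inv_sqrt_sq_mul_le_one (d : ℝ) : (√d)⁻¹ ^ 2 * d ≤ 1 := by
  rcases le_or_gt d 0 with h | h
  · simp [Real.sqrt_eq_zero_of_nonpos h]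
  · rw [inv_pow, Real.sq_sqrt h.le, inv_mul_cancel₀ h.ne']

/-- A normalized adjacency matrix is a contraction, also in the presence of isolated vertices. -/
theorem opNorm_normalized_le_one {M : Matrix (Fin n) (Fin n) ℝ} (hM : M.IsSymm)
    (h0 : ∀ i j, 0 ≤ M i j) {d : Fin n → ℝ} (hd : ∀ i, d i = ∑ j, M i j) :
    opNorm (diagonal (fun i => (√(d i))⁻¹) * M * diagonal (fun i => (√(d i))⁻¹)) ≤ 1 := by
  refine opNorm_le_of_forall zero_le_one fun v => ?_
  set g : Fin n → ℝ := fun i => (√(d i))⁻¹ with hg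
  have hgd : ∀ i, g i ^ 2 * d i ≤ 1 := fun i => inv_sqrt_sq_mul_le_one (d i)
  have happ : ∀ i, ((diagonal g * M * diagonal g) *ᵥ v) i = g i * ∑ j, M i j * (g j * v j) := by
    intro i
    simp only [mulVec, dotProduct, mul_diagonal, diagonal_mul, Finset.mul_sum]
    exact Finset.sum_congr rfl fun j _ => by ring
  have hrow : ∀ i, (g i * ∑ j, M i j * (g j * v j)) ^ 2 ≤ ∑ j, M i j * (g j * v j) ^ 2 := by
    intro i
    have hS : 0 ≤ ∑ j, M i j * (g j * v j) ^ 2 :=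
      Finset.sum_nonneg fun j _ => mul_nonneg (h0 i j) (sq_nonneg _)
    have hcs : (∑ j, M i j * (g j * v j)) ^ 2 ≤ d i * ∑ j, M i j * (g j * v j) ^ 2 := by
      rw [hd]
      refine Finset.sum_sq_le_sum_mul_sum_of_sq_le_mul _ (fun j _ => h0 i j)
        (fun j _ => mul_nonneg (h0 i j) (sq_nonneg _)) fun j _ => le_of_eq (by ring)
    calc (g i * ∑ j, M i j * (g j * v j)) ^ 2
        = g i ^ 2 * (∑ j, M i j * (g j * v j)) ^ 2 := by ring
      _ ≤ g i ^ 2 * (d i * ∑ j, M i j * (g j * v j) ^ 2) := by gcongr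
      _ = (g i ^ 2 * d i) * ∑ j, M i j * (g j * v j) ^ 2 := by ring
      _ ≤ 1 * ∑ j, M i j * (g j * v j) ^ 2 := by gcongr; exact hgd i
      _ = _ := one_mul _
  calc _ = ∑ i, (g i * ∑ j, M i j * (g j * v j)) ^ 2 := by
        simp only [dotProduct, happ, sq]
    _ ≤ ∑ i, ∑ j, M i j * (g j * v j) ^ 2 := Finset.sum_le_sum fun i _ => hrow i
    _ = ∑ j, (g j ^ 2 * d j) * (v j * v j) := by
        rw [Finset.sum_comm]
        refine Finset.sum_congr rfl fun j _ => ?_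
        rw [← Finset.sum_mul, hd j]
        simp only [hM.apply]
        ring
    _ ≤ ∑ j, 1 * (v j * v j) := Finset.sum_le_sum fun j _ =>
        mul_le_mul_of_nonneg_right (hgd j) (mul_self_nonneg _)
    _ = _ := by simp [dotProduct]

theorem opNorm_normLaplacian_sub_le_two {M N : Matrix (Fin n) (Fin n) ℝ} (hM : M.IsSymm)
    (hN : N.IsSymm) (hM0 : ∀ i j, 0 ≤ M i j) (hN0 : ∀ i j, 0 ≤ N i j) {d d' : Fin n → ℝ}
    (hd : ∀ i, d i = ∑ j, M i j) (hd' : ∀ i, d' i = ∑ j, N i j) :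
    opNorm (normLaplacian M d - normLaplacian N d') ≤ 2 := by
  have h1 := opNorm_normalized_le_one hM hM0 hd
  have h2 := opNorm_normalized_le_one hN hN0 hd'
  rw [normLaplacian, normLaplacian, sub_sub_sub_cancel_left, sub_eq_add_neg]
  refine (opNorm_add_le _ _).trans ?_
  rw [opNorm_neg]
  linarith

/-- Perturbation of the normalized Laplacian: with `ψ = D'^(-1/2) D^(1/2)`, the normalized
adjacency matrices differ by `D'^(-1/2) (N - M) D'^(-1/2)` and by the effect of multiplying a
matrix of norm at most `1` by the nearly trivial `ψ` from both sides. -/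
theorem opNorm_normLaplacian_sub_le {M N : Matrix (Fin n) (Fin n) ℝ} (hM : M.IsSymm)
    (hM0 : ∀ i j, 0 ≤ M i j) {d d' : Fin n → ℝ} (hd : ∀ i, d i = ∑ j, M i j)
    (hd' : ∀ i, 0 < d' i) {η : ℝ} (hη : η ≤ 1 / 2)
    (hdd : ∀ i, |(d' i)⁻¹ * (d i - d' i)| ≤ η)
    (hMN : opNorm (Matrix.of fun a b => (√(d' a))⁻¹ * (√(d' b))⁻¹ * (M a b - N a b)) ≤ η) :
    opNorm (normLaplacian M d - normLaplacian N d') ≤ 4 * η := by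
  have hη0 : 0 ≤ η := (opNorm_nonneg _).trans hMN
  set g : Fin n → ℝ := fun i => (√(d i))⁻¹ with hg
  set g' : Fin n → ℝ := fun i => (√(d' i))⁻¹ with hg'
  set ψ : Fin n → ℝ := fun i => √(d i / d' i) with hψ
  have hratio : ∀ i, |d i / d' i - 1| ≤ η := fun i => by
    have : d i / d' i - 1 = (d' i)⁻¹ * (d i - d' i) := by
      have := (hd' i).ne'
      field_simp
    rw [this]; exact hdd i
  have hdpos : ∀ i, 0 < d i := fun i => by
    have h1 := (abs_le.1 (hratio i)).1
    have h2 : 0 < d i / d' i := by linarith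
    have := mul_pos h2 (hd' i)
    rwa [div_mul_cancel₀ _ (hd' i).ne'] at this
  have hψ1 : ∀ i, |ψ i - 1| ≤ η := fun i => by
    have h0 : 0 ≤ ψ i := Real.sqrt_nonneg _
    have h1 : ψ i ^ 2 = d i / d' i := Real.sq_sqrt (div_pos (hdpos i) (hd' i)).le
    have h2 : |ψ i ^ 2 - 1| ≤ η := by rw [h1]; exact hratio i
    have h3 : ψ i ^ 2 - 1 = (ψ i - 1) * (ψ i + 1) := by ring
    rw [h3, abs_mul, abs_of_pos (by linarith : 0 < ψ i + 1)] at h2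
    nlinarith [abs_nonneg (ψ i - 1)]
  have hψg : ∀ i, ψ i * g i = g' i := fun i => by
    have h1 : √(d i) ≠ 0 := (Real.sqrt_pos.2 (hdpos i)).ne'
    simp only [hψ, hg, hg', Real.sqrt_div (hdpos i).le]
    field_simp
  set Z := diagonal g * M * diagonal g with hZ
  have hZ1 : opNorm Z ≤ 1 := opNorm_normalized_le_one hM hM0 hd
  have hdecomp : normLaplacian M d - normLaplacian N d' =
      -(Matrix.of fun a b => g' a * g' b * (M a b - N a b)) +
        (diagonal ψ * Z * diagonal (fun i => ψ i - 1) + diagonal (fun i => ψ i - 1) * Z) := by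
    rw [normLaplacian, normLaplacian, sub_sub_sub_cancel_left]
    ext a b
    have ha : (√(d' a))⁻¹ = ψ a * (√(d a))⁻¹ := (hψg a).symm
    have hb : (√(d' b))⁻¹ = ψ b * (√(d b))⁻¹ := (hψg b).symm
    simp only [Matrix.sub_apply, Matrix.add_apply, Matrix.neg_apply, Matrix.of_apply, hZ, hg, hg',
      mul_diagonal, diagonal_mul]
    rw [ha, hb]
    ring
  have hD1 : opNorm (diagonal fun i => ψ i - 1) ≤ η := opNorm_diagonal_le hη0 hψ1
  have hD2 : opNorm (diagonal ψ) ≤ 3 / 2 := opNorm_diagonal_le (by norm_num) fun i => by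
    have h1 := abs_le.1 (hψ1 i)
    rw [abs_of_nonneg (Real.sqrt_nonneg _)]
    linarith [h1.2]
  have hT1 : opNorm (diagonal ψ * Z * diagonal fun i => ψ i - 1) ≤ 3 / 2 * 1 * η := by
    refine (opNorm_mul_le _ _).trans ?_
    refine mul_le_mul ((opNorm_mul_le _ _).trans ?_) hD1 (opNorm_nonneg _) (by norm_num)
    exact mul_le_mul hD2 hZ1 (opNorm_nonneg _) (by norm_num)
  have hT2 : opNorm ((diagonal fun i => ψ i - 1) * Z) ≤ η * 1 :=
    (opNorm_mul_le _ _).trans (mul_le_mul hD1 hZ1 (opNorm_nonneg _) hη0)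
  rw [hdecomp]
  refine (opNorm_add_le _ _).trans ?_
  rw [opNorm_neg]
  have := opNorm_add_le (diagonal ψ * Z * diagonal fun i => ψ i - 1)
    ((diagonal fun i => ψ i - 1) * Z)
  linarith

end Laplacian

/-! ### Concentration of the adjacency matrix and of the Laplacian -/

section Main

theorem one_sub_le_measureReal {Ω : Type*} [MeasurableSpace Ω] {μ : Measure Ω}
    [IsProbabilityMeasure μ] {G B : Set Ω} {δ : ℝ} (hGB : Gᶜ ⊆ B) (hB : μ.real B ≤ δ) :
    1 - δ ≤ μ.real G := by
  have h1 : μ.real (Set.univ : Set Ω) ≤ μ.real G + μ.real B := by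
    refine le_trans (measureReal_mono ?_) (measureReal_union_le G B)
    intro ω _
    by_cases h : ω ∈ G
    · exact Or.inl h
    · exact Or.inr (hGB h)
  rw [probReal_univ] at h1
  linarith

variable {n K : ℕ} {Ω : Type*} [MeasurableSpace Ω] {μ : Measure Ω}
  {P : Matrix (Fin n) (Fin n) ℝ} {α : ℝ} {A : Fin (K + 1) → Ω → Matrix (Fin n) (Fin n) ℝ}

theorem sum_le_dMax (P : Matrix (Fin n) (Fin n) ℝ) (i : Fin n) : ∑ j, P i j ≤ dMax P :=
  le_ciSup (Set.finite_range fun i => ∑ j, P i j).bddAbove i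

theorem dMin_le_sum (P : Matrix (Fin n) (Fin n) ℝ) (i : Fin n) : dMin P ≤ ∑ j, P i j :=
  ciInf_le (Set.finite_range fun i => ∑ j, P i j).bddBelow i

theorem IsLazyIER.adjacency_concentration [IsProbabilityMeasure μ]
    (hA : IsLazyIER μ P α A) (hα : α ∈ Set.Ioo (0 : ℝ) 1)
    (hP : ∀ i j, P i j ∈ Set.Icc (0 : ℝ) 1) (hPs : P.IsSymm) (hn : 1 ≤ n) {δ : ℝ} (hδ : 0 < δ)
    (hδ' : δ < 1 / 2) (hD : 2 * Real.log (n / δ) ≤ (K + 1) * dMax P) :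
    1 - δ ≤ μ.real {ω | opNorm (aggAdj A ω - meanAdj μ A) ≤
      2 * concConst α * √((K + 1) * dMax P * Real.log (n / δ))} := by
  have hn' : (1 : ℝ) ≤ n := by exact_mod_cast hn
  have hnδ : 1 < n / δ := by rw [lt_div_iff₀ hδ]; linarith
  set L := Real.log (n / δ) with hL
  have hL0 : 0 < L := Real.log_pos hnδ
  set D := (K + 1) * dMax P with hDdef
  have hD0 : 0 < D := by linarith
  have hB : 0 < concConst α := by linarith [four_lt_concConst hα]
  have h := hA.measureReal_opNorm_weighted_gt_le hα hP hPs (w := Matrix.of fun _ _ => D⁻¹)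
    (Matrix.IsSymm.ext fun i j => rfl) hD0 (by positivity) hD
    (fun a b => by simp [abs_of_pos hD0]) (fun b => by
      simp only [Matrix.of_apply]
      rw [← Finset.sum_mul, ← Finset.mul_sum]
      have h1 : ∑ a, P a b ≤ dMax P := by
        refine le_trans (le_of_eq ?_) (sum_le_dMax P b)
        exact Finset.sum_congr rfl fun a _ => hPs.apply b a
      calc (K + 1) * (∑ a, P a b) * D⁻¹ ^ 2 ≤ D * D⁻¹ ^ 2 := by
            rw [hDdef]; gcongr
        _ = D⁻¹ := by field_simp)
  refine one_sub_le_measureReal ?_ (h.trans ?_)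
  · intro ω hω
    simp only [Set.mem_compl_iff, Set.mem_ofPred_eq, not_le] at hω ⊢
    have h1 : (Matrix.of fun a b => (Matrix.of fun _ _ => D⁻¹ : Matrix (Fin n) (Fin n) ℝ) a b *
        (aggAdj A ω a b - meanAdj μ A a b)) = D⁻¹ • (aggAdj A ω - meanAdj μ A) := by
      ext a b; simp
    rw [h1, opNorm_smul, abs_of_pos (inv_pos.2 hD0), ← div_eq_inv_mul, lt_div_iff₀ hD0]
    refine lt_of_le_of_lt ?_ hω
    have h2 : √(2 * L / D) * D = √(2 * (D * L)) := by
      nth_rewrite 2 [← Real.sqrt_sq hD0.le]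
      rw [← Real.sqrt_mul (by positivity)]
      congr 1
      field_simp
    have h3 : √(2 * (D * L)) ≤ 2 * √(D * L) := by
      rw [Real.sqrt_le_left (by positivity), mul_pow, Real.sq_sqrt (by positivity)]
      nlinarith [mul_pos hD0 hL0]
    calc concConst α * √(2 * L / D) * D = concConst α * √(2 * (D * L)) := by
          rw [mul_assoc, h2]
      _ ≤ concConst α * (2 * √(D * L)) := by gcongr
      _ = _ := by ring
  · have h1 : Real.exp (-(2 * L)) = (δ / n) ^ 2 := by
      rw [← mul_neg, ← Nat.cast_ofNat (R := ℝ), Real.exp_nat_mul, Real.exp_neg, hL,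
        Real.exp_log (by positivity), inv_div]
    rw [h1]
    have h2 : 2 * n * (δ / n) ^ 2 = 2 * δ * (δ / n) := by field_simp
    have h3 : δ / n ≤ 1 / 2 := by
      rw [div_le_iff₀ (by linarith)]; linarith
    rw [h2]
    nlinarith

theorem IsLazyIER.laplacian_concentration [IsProbabilityMeasure μ]
    (hA : IsLazyIER μ P α A) (hα : α ∈ Set.Ioo (0 : ℝ) 1)
    (hP : ∀ i j, P i j ∈ Set.Icc (0 : ℝ) 1) (hPs : P.IsSymm) (hn : 1 ≤ n) {δ : ℝ} (hδ : 0 < δ)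
    (hδ' : δ < 1 / 2) (hD : 0 < (K + 1) * dMin P) :
    1 - δ ≤ μ.real {ω | opNorm (aggLaplacian A ω - meanLaplacian μ A) ≤
      4 * concConst α * √(Real.log (4 * n / δ) / ((K + 1) * dMin P))} := by
  have hn' : (1 : ℝ) ≤ n := by exact_mod_cast hn
  have hnδ : 1 < 4 * n / δ := by rw [lt_div_iff₀ hδ]; linarith
  set L := Real.log (4 * n / δ) with hL
  have hL0 : 0 < L := Real.log_pos hnδ
  set m := (K + 1) * dMin P with hm
  have hB4 := four_lt_concConst hα
  have hB : 0 < concConst α := by linarith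
  have hdeg : ∀ i, (K + 1) * ∑ j, P i j = meanDegree μ A i := fun i => by
    rw [hA.meanDegree_eq, Finset.mul_sum]
    exact Finset.sum_congr rfl fun j _ => (hA.meanAdj_apply hα hP hPs i j).symm
  have hmd : ∀ i, m ≤ meanDegree μ A i := fun i => by
    rw [← hdeg, hm]
    gcongr
    exact dMin_le_sum P i
  have hmd0 : ∀ i, 0 < meanDegree μ A i := fun i => hD.trans_le (hmd i)
  have hsymm : ∀ ω, (aggAdj A ω).IsSymm := fun ω => Matrix.IsSymm.ext fun i j => by
    simp only [aggAdj_apply, (hA.isAdjacency _ ω).1.apply i j]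
  have hnonneg : ∀ ω i j, 0 ≤ aggAdj A ω i j := fun ω i j => by
    rw [aggAdj_apply]
    refine Finset.sum_nonneg fun t _ => ?_
    rcases (hA.isAdjacency t ω).2 i j with h | h <;> simp [h]
  have hmsymm : (meanAdj μ A).IsSymm := Matrix.IsSymm.ext fun i j => by
    simp only [hA.meanAdj_apply hα hP hPs, hPs.apply i j]
  have hmnonneg : ∀ i j, 0 ≤ meanAdj μ A i j := fun i j => by
    rw [hA.meanAdj_apply hα hP hPs]
    have := (hP i j).1
    positivity
  set η := concConst α * √(L / m) with hη
  have h4η : 4 * concConst α * √(L / m) = 4 * η := by rw [hη]; ring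
  rw [h4η]
  -- if `η` is not small, the bound exceeds the a priori bound `2`
  rcases le_or_gt (1 / 2) η with hbig | hsmall
  · refine one_sub_le_measureReal (B := ∅) ?_ (by simpa using hδ.le)
    intro ω hω
    refine hω ?_
    simp only [Set.mem_ofPred_eq]
    exact (opNorm_normLaplacian_sub_le_two (hsymm ω) hmsymm (hnonneg ω) hmnonneg
      (aggDegree_eq A ω) hA.meanDegree_eq).trans (by linarith)
  have hLm : L ≤ m := by
    have h1 : √(L / m) < 1 := by
      have := Real.sqrt_nonneg (L / m)
      nlinarith
    rw [Real.sqrt_lt' one_pos, one_pow, div_lt_one hD] at h1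
    exact h1.le
  set g : Fin n → ℝ := fun i => (√(meanDegree μ A i))⁻¹ with hg
  have hg0 : ∀ i, 0 ≤ g i := fun i => inv_nonneg.2 (Real.sqrt_nonneg _)
  have hg2 : ∀ i, g i ^ 2 = (meanDegree μ A i)⁻¹ := fun i => by
    rw [hg, inv_pow, Real.sq_sqrt (hmd0 i).le]
  have hgm : ∀ i, g i ^ 2 ≤ m⁻¹ := fun i => by
    rw [hg2]
    exact inv_anti₀ hD (hmd i)
  have h1 := hA.measureReal_opNorm_weighted_gt_le hα hP hPs
    (w := Matrix.of fun a b => g a * g b) (Matrix.IsSymm.ext fun i j => mul_comm _ _) hD hL0.le hLm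
    (fun a b => by
      rw [Matrix.of_apply, abs_of_nonneg (mul_nonneg (hg0 a) (hg0 b))]
      nlinarith [hgm a, hgm b, sq_nonneg (g a - g b)])
    (fun b => by
      calc ∑ a, (K + 1) * P a b * (Matrix.of fun a b => g a * g b) a b ^ 2
          ≤ ∑ a, (K + 1) * P a b * (m⁻¹ * g b ^ 2) := by
            refine Finset.sum_le_sum fun a _ => ?_
            have h0 := (hP a b).1
            rw [Matrix.of_apply, mul_pow]
            gcongr
            exact hgm a
        _ = m⁻¹ * (meanDegree μ A b * g b ^ 2) := by
            rw [← Finset.sum_mul, ← Finset.mul_sum, ← hdeg]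
            have : ∑ a, P a b = ∑ a, P b a := Finset.sum_congr rfl fun a _ => hPs.apply b a
            rw [this]; ring
        _ = m⁻¹ := by rw [hg2, mul_inv_cancel₀ (hmd0 b).ne', mul_one])
  have h2 := hA.measureReal_opNorm_degree_gt_le hα hP hPs
    (u := fun a => (meanDegree μ A a)⁻¹) hD hL0.le hLm
    (fun a => by rw [abs_of_pos (inv_pos.2 (hmd0 a)), ← hg2]; exact hgm a)
    (fun a => by
      rw [← Finset.mul_sum, hdeg, sq, ← mul_assoc, mul_inv_cancel₀ (hmd0 a).ne', one_mul, ← hg2]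
      exact hgm a)
  have hexp : Real.exp (-L) = δ / (4 * n) := by
    rw [Real.exp_neg, hL, Real.exp_log (by positivity), inv_div]
  have hhalf : 2 * n * Real.exp (-L) = δ / 2 := by
    rw [hexp]; field_simp; ring
  rw [hhalf] at h1 h2
  refine one_sub_le_measureReal ?_ ((measureReal_union_le _ _).trans
    ((add_le_add h1 h2).trans_eq (add_halves δ)))
  intro ω hω
  by_contra hcon
  simp only [Set.mem_union, Set.mem_ofPred_eq, not_or, not_lt] at hcon
  refine hω (opNorm_normLaplacian_sub_le (hsymm ω) (hnonneg ω) (aggDegree_eq A ω) hmd0 hsmall.le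
    (fun i => ?_) hcon.1)
  refine le_trans ?_ hcon.2
  have := abs_apply_le_opNorm
    (diagonal fun a => (meanDegree μ A a)⁻¹ * (aggDegree A ω a - meanDegree μ A a)) i i
  rwa [diagonal_apply_eq] at this

/-- The logarithmic factor in the bound is at most of order `log n`, hence dominated by
`log n ^ 3`. -/
theorem log_div_le_log_cube {n : ℕ} (hn : 2 ≤ n) {c δ : ℝ} (hδ : (n : ℝ) ^ (-c) < δ)
    (hc : 0 < c) :
    2 * Real.log (n / δ) ≤ 2 * (1 + c) / Real.log 2 ^ 2 * Real.log n ^ 3 := by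
  have hn' : (2 : ℝ) ≤ n := by exact_mod_cast hn
  have hn0 : (0 : ℝ) < n := by linarith
  have hδ0 : 0 < δ := (Real.rpow_pos_of_pos hn0 _).trans hδ
  have h2 : 0 < Real.log 2 := Real.log_pos one_lt_two
  have hln : Real.log 2 ≤ Real.log n := Real.log_le_log two_pos hn'
  have h1 : -c * Real.log n ≤ Real.log δ := by
    rw [← Real.log_rpow hn0]
    exact Real.log_le_log (Real.rpow_pos_of_pos hn0 _) hδ.le
  have h3 : Real.log (n / δ) ≤ (1 + c) * Real.log n := by
    rw [Real.log_div hn0.ne' hδ0.ne']; linarith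
  have h4 : Real.log 2 ^ 2 * Real.log n ≤ Real.log n ^ 3 := by
    have : Real.log n ^ 3 = Real.log n ^ 2 * Real.log n := by ring
    rw [this]
    have h5 : 0 ≤ Real.log n := by linarith
    gcongr
  rw [div_mul_eq_mul_div, le_div_iff₀ (by positivity)]
  calc 2 * Real.log (n / δ) * Real.log 2 ^ 2 ≤ 2 * ((1 + c) * Real.log n) * Real.log 2 ^ 2 := by
        gcongr
    _ = 2 * (1 + c) * (Real.log 2 ^ 2 * Real.log n) := by ring
    _ ≤ _ := by gcongr

end Main

end LazyIER

theorem theorem2p1 :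
    ∃ C₂ : ℝ → ℝ, (∀ α ∈ Set.Ioo (0 : ℝ) 1, 0 < C₂ α) ∧
    ∀ c : ℝ, 0 < c →
    ∃ C : ℝ, 0 < C ∧
    ∃ C₁ : ℝ → ℝ, (∀ α ∈ Set.Ioo (0 : ℝ) 1, 0 < C₁ α) ∧
    ∀ (n T : ℕ), 1 ≤ n → 2 ≤ T →
    ∀ (P : Matrix (Fin n) (Fin n) ℝ), P.IsSymm → (∀ i j, P i j ∈ Set.Icc (0 : ℝ) 1) →
    ∀ α ∈ Set.Ioo (0 : ℝ) 1,
    ∀ (Ω : Type*) [MeasurableSpace Ω] (μ : MeasureTheory.Measure Ω)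
      [MeasureTheory.IsProbabilityMeasure μ]
      (A : Fin T → Ω → Matrix (Fin n) (Fin n) ℝ), LazyIER.IsLazyIER μ P α A →
      (C * Real.log n ^ 3 < T * LazyIER.dMax P →
        ∀ δ ∈ Set.Ioo ((n : ℝ) ^ (-c)) (1 / 2),
          1 - δ ≤ μ.real {ω | LazyIER.opNorm (LazyIER.aggAdj A ω - LazyIER.meanAdj μ A) ≤
            C₁ α * √(T * LazyIER.dMax P * Real.log (n / δ))}) ∧
      (C * Real.log n ^ 3 < T * LazyIER.dMin P →
        ∀ δ ∈ Set.Ioo ((n : ℝ) ^ (-c)) (1 / 2),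
          1 - δ ≤ μ.real {ω |
            LazyIER.opNorm (LazyIER.aggLaplacian A ω - LazyIER.meanLaplacian μ A) ≤
              C₂ α * √(Real.log (4 * n / δ) / (T * LazyIER.dMin P))}) := by
  refine ⟨fun α => 4 * LazyIER.concConst α, fun α hα => by
    linarith [LazyIER.four_lt_concConst hα], fun c hc => ?_⟩
  have hlog2 : 0 < Real.log 2 := Real.log_pos one_lt_two
  refine ⟨2 * (1 + c) / Real.log 2 ^ 2, by positivity, fun α => 2 * LazyIER.concConst α,
    fun α hα => by linarith [LazyIER.four_lt_concConst hα], ?_⟩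
  intro n T hn hT P hPs hP α hα Ω _ μ _ A hA
  obtain ⟨K, rfl⟩ : ∃ K, T = K + 1 := ⟨T - 1, by omega⟩
  have hn0 : (0 : ℝ) < n := by exact_mod_cast hn
  have hpos : ∀ δ ∈ Set.Ioo ((n : ℝ) ^ (-c)) (1 / 2), 0 < δ := fun δ hδ =>
    (Real.rpow_pos_of_pos hn0 _).trans hδ.1
  push_cast
  refine ⟨fun hD δ hδ => ?_, fun hD δ hδ => ?_⟩
  · -- for `n = 1` there is no admissible `δ`
    have hn2 : 2 ≤ n := by
      by_contra hlt
      obtain rfl : n = 1 := by omega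
      have h1 := hδ.1
      have h2 := hδ.2
      rw [Nat.cast_one, Real.one_rpow] at h1
      linarith
    exact hA.adjacency_concentration hα hP hPs hn (hpos δ hδ) hδ.2
      ((LazyIER.log_div_le_log_cube hn2 hδ.1 hc).trans hD.le)
  · refine hA.laplacian_concentration hα hP hPs hn (hpos δ hδ) hδ.2 (lt_of_le_of_lt ?_ hD)
    have : 0 ≤ Real.log n := Real.log_nonneg (by exact_mod_cast hn)
    positivity
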